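/- Let $T>0$ and $c>0$, put $W=cT$, $\mathbf T=[-T,T]^2$, $\mathbf W=[-W,W]^2$, and let $\mathbb H$ be the real quaternions with units $\mathbf i,\mathbf j,\mathbf k$. For $f\in L^1(\mathbb R^2;\mathbb H)$ let $\mathcal F(f)(u,v)=\frac1{2\pi}\int_{\mathbb R^2}e^{-\mathbf i ux}f(x,y)e^{-\mathbf j vy}\,dx\,dy$ be the two-sided quaternionic Fourier transform, extended to $L^2(\mathbb R^2;\mathbb H)$ as the $L^2$-limit, as $R\to\infty$, of the transforms of the truncations of $f$ to $[-R,R]^2$, and let $\mathcal B_{\mathbf W}$ be the space of all $f\in L^2(\mathbb R^2;\mathbb H)$ whose transform vanishes almost everywhere outside $\mathbf W$. Then there are a sequence of functions $\psi_n:\mathbb R^2\to\mathbb H$ ($n=0,1,2,\dots$) in $L^2(\mathbb R^2;\mathbb H)$, complex numbers $\mu_n$ (regarded as quaternions $a+b\mathbf i$) and real numbers $\lambda_n$ such that the following hold. The $\psi_n$ are quaternionic prolate spheroidal wave functions (QPSWFs), that is, $$\mu_n\,\mathbf i^n\psi_n(x,y)\,\mathbf j^n=\int_{\mathbf T}e^{\mathbf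 i csx}\,\psi_n(s,t)\,e^{\mathbf j cty}\,ds\,dt\qquad\text{for all }(x,y)\in\mathbb R^2,\ n\ge 0,$$ and $\{\psi_n\}$ is complete in $\mathcal B_{\mathbf W}$: all $\psi_n$ lie in $\mathcal B_{\mathbf W}$, and the finite sums $\sum a_n\psi_n$ with $a_n\in\mathbb H$ are dense in $\mathcal B_{\mathbf W}$ for the $L^2$ norm. Moreover $\psi_n$ is an eigenfunction, with eigenvalue $\lambda_n$, of the two-dimensional sinc-kernel operator: $$\lambda_n\psi_n(x,y)=\int_{\mathbf T}\psi_n(s,t)\,\frac{\sin W(x-s)}{\pi(x-s)}\,\frac{\sin W(y-t)}{\pi(y-t)}\,ds\,dt\qquad\text{for all }(x,y)\in\mathbb R^2,\ n\ge 0.$$ 1. The $\lambda_n$ are real and lie in $(0,1)$, $\lambda_0\ge\lambda_1\ge\lambda_2\ge\cdots$, and $\lim_{n\to\infty}\lambda_n=0$. 2. The $\psi_n$ are orthogonal on $\mathbf T$: $\int_{\mathbf T}\psi_n\overline{\psi_m}\,dx\,dy=\lambda_n\delta_{mn}$ for all $m,n$. 3. The $\psi_n$ are orthonormal on $\mathbb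 R^2$: $\int_{\mathbb R^2}\psi_n\overline{\psi_m}\,dx\,dy=\delta_{mn}$ for all $m,n$. -/

import Mathlib

open MeasureTheory Filter Topology

namespace QPSWF

noncomputable section

/-- The quaternion unit `i`. -/
def qI : Quaternion ℝ := ⟨0, 1, 0, 0⟩

/-- The quaternion unit `j`. -/
def qJ : Quaternion ℝ := ⟨0, 0, 1, 0⟩

/-- `e^{iθ} = cos θ + i sin θ`. -/
def expI (θ : ℝ) : Quaternion ℝ := ⟨Real.cos θ, Real.sin θ, 0, 0⟩

/-- `e^{jθ} = cos θ + j sin θ`. -/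
def expJ (θ : ℝ) : Quaternion ℝ := ⟨Real.cos θ, 0, Real.sin θ, 0⟩

/-- The square `[-R, R] × [-R, R]` in `ℝ²`. -/
def square (R : ℝ) : Set (ℝ × ℝ) := Set.Icc (-R) R ×ˢ Set.Icc (-R) R

/-- The two-sided quaternionic Fourier transform
`F(f)(u,v) = (1/2π) ∫_{ℝ²} e^{-iux} f(x,y) e^{-jvy} dx dy` of an integrable function `f`. -/
def qft (f : ℝ × ℝ → Quaternion ℝ) (w : ℝ × ℝ) : Quaternion ℝ :=
  (1 / (2 * Real.pi)) •
    ∫ p : ℝ × ℝ, expI (-(w.1 * p.1)) * f p * expJ (-(w.2 * p.2))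

/-- `g` is the quaternionic Fourier transform of the square-integrable function `f` in the
Plancherel sense: `g` is the `L²` limit of the transforms of the truncations of `f` to the
squares `[-R, R]²` (which are integrable). -/
def IsL2QFT (f g : ℝ × ℝ → Quaternion ℝ) : Prop :=
  MemLp f 2 ∧ MemLp g 2 ∧
    Tendsto (fun R : ℝ => eLpNorm (fun w => qft ((square R).indicator f) w - g w) 2 volume)
      atTop (𝓝 0)

/-- The Paley-Wiener class of quaternion-valued functions in `L²(ℝ²)` that are bandlimited to the
square `[-W, W]²`. -/
def Bandlimited (W : ℝ) (f : ℝ × ℝ → Quaternion ℝ) : Prop :=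
  ∃ g : ℝ × ℝ → Quaternion ℝ, IsL2QFT f g ∧ ∀ᵐ w : ℝ × ℝ, w ∉ square W → g w = 0

/-- The sequence `ψ` is complete in the class of functions bandlimited to `[-W, W]²`: its members
belong to the class, and their finite combinations with quaternion coefficients on the left are
dense in it for the `L²` norm. -/
def CompleteInBandlimited (W : ℝ) (ψ : ℕ → ℝ × ℝ → Quaternion ℝ) : Prop :=
  (∀ n, Bandlimited W (ψ n)) ∧
    ∀ f : ℝ × ℝ → Quaternion ℝ, Bandlimited W f → ∀ ε : ENNReal, 0 < ε →
      ∃ (N : ℕ) (a : ℕ → Quaternion ℝ),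
        eLpNorm (fun p => f p - ∑ n ∈ Finset.range N, a n * ψ n p) 2 volume < ε

/-- The sequence `ψ` consists of quaternionic prolate spheroidal wave functions for the
time-domain `[-T, T]²` and the frequency-domain `[-cT, cT]²`, with complex parameters `μ n`
(complex numbers are the quaternions `a + b i`): the finite quaternionic Fourier
transform equation
`μ_n iⁿ ψ_n(x,y) jⁿ = ∫_{[-T,T]²} e^{icsx} ψ_n(s,t) e^{jcty} ds dt`
holds for all `(x,y)` in `ℝ²`, and the sequence is complete in the bandlimited functions. -/
structure IsQPSWF (T c : ℝ) (ψ : ℕ → ℝ × ℝ → Quaternion ℝ) (μ : ℕ → ℂ) : Prop where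
  finite_qft : ∀ (n : ℕ) (z : ℝ × ℝ),
    (μ n : Quaternion ℝ) * qI ^ n * ψ n z * qJ ^ n =
      ∫ p in square T, expI (c * p.1 * z.1) * ψ n p * expJ (c * p.2 * z.2)
  complete : CompleteInBandlimited (c * T) ψ

/-- The kernel `sin W(x-s) / (π(x-s)) * sin W(y-t) / (π(y-t))`, with the value `W/π` of each factor
on its removable singularity. -/
def sincKernel (W : ℝ) (z p : ℝ × ℝ) : ℝ :=
  (W / Real.pi * Real.sinc (W * (z.1 - p.1))) * (W / Real.pi * Real.sinc (W * (z.2 - p.2)))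

/-- The operator `(K f)(x,y) = ∫_{[-T,T]²} k(x,y,s,t) f(s,t) ds dt` with the sinc kernel `k`. -/
def sincOperator (T W : ℝ) (f : ℝ × ℝ → Quaternion ℝ) (z : ℝ × ℝ) : Quaternion ℝ :=
  ∫ p in square T, sincKernel W z p • f p

end

end QPSWF

/-! The two-sided transform becomes an ordinary complex Fourier transform after a choice of
coordinates. The unit quaternion `q = (i + j)/√2` satisfies `q j = i q`, hence `q e^{jθ} = e^{iθ}
q`, and every quaternion is uniquely `z q + j w q` with `z`, `w` complex. On `ℂ q` the kernel
`e^{iα} · e^{jβ}` multiplies `z` by `e^{i(α+β)}`; on `j ℂ q` it multiplies `w` by `e^{i(-α+β)}`,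
which is the same transform with the first frequency reflected. So it suffices to find complex
prolate functions `φ_n` on the plane and put `ψ_n = φ_n q`.

Let `A` be the finite Fourier transform with kernel `e^{ic z·p}` on `L²([-T,T]²)` and `R` the
reflection. `A` is Hilbert-Schmidt, hence compact, and `A† = A R = R A`, so `A` is normal.
`exists_orthonormal_eigenvectors` diagonalises it through a self-adjoint combination of `A` and `A
R`. `A` is injective, because the transform of a compactly supported function is analytic along
lines and so cannot vanish on an open set unless it is zero. Hence all eigenvalues `m_n` are
nonzero; as the space is infinite-dimensional there are infinitely many, and they can be sorted by
decreasing `|m_n|`, which tends to `0`.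

For an eigenvector `e_n` let `φ_n` be the unitary Fourier transform, scaled by `c`, of `e_n`
extended by zero. Unitarity gives orthonormality on the plane, and the image of all extended
functions is exactly the complex bandlimited class, which gives completeness. On the square `φ_n =
(c/2π) m_n e_n`, which gives orthogonality there with `λ_n = (c/2π)² |m_n|²`. The sinc kernel is
`(c/2π)²` times the kernel of `A A†`, so `λ_n` is also its eigenvalue. Finally `λ_n` is the mass of
`φ_n` inside the square; it is less than `1`, since otherwise `φ_n` would vanish on an open set. -/

namespace QPSWF

/-! ### Enumerating a null family in decreasing order. -/

section Sorting

/-- A positive function on an infinite type that tends to `0` along the cofinite filter can be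
enumerated in decreasing order. -/
theorem exists_bijective_antitone {ι : Type*} [Infinite ι] (r : ι → ℝ) (hr : ∀ i, 0 < r i)
    (h0 : Tendsto r cofinite (𝓝 0)) :
    ∃ σ : ℕ → ι, Function.Bijective σ ∧ Antitone (r ∘ σ) ∧ Tendsto (r ∘ σ) atTop (𝓝 0) := by
  classical
  have hfin (a : ℝ) (ha : 0 < a) : {i | a ≤ r i}.Finite := by
    have := h0.eventually (gt_mem_nhds ha)
    simpa [Filter.eventually_cofinite] using this
  have hmax (F : Finset ι) : ∃ x, x ∉ F ∧ ∀ y, y ∉ F → r y ≤ r x := by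
    obtain ⟨y, hy⟩ := Infinite.exists_notMem_finset F
    obtain ⟨x, hx, hmx⟩ := Set.exists_max_image ({i | r y ≤ r i} \ F) r
      ((hfin _ (hr y)).subset Set.sdiff_subset) ⟨y, by simp, by simpa using hy⟩
    refine ⟨x, by simpa using hx.2, fun z hz => ?_⟩
    rcases le_total (r y) (r z) with h | h
    · exact hmx z ⟨h, by simpa using hz⟩
    · exact h.trans hx.1
  choose next hnext hle using hmax
  -- Greedy choice: `g n` holds the first `n` picks, and each new pick maximises `r` off `g n`.
  let g : ℕ → Finset ι := fun n => Nat.rec ∅ (fun _ F => insert (next F) F) n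
  have hg (n : ℕ) : g (n + 1) = insert (next (g n)) (g n) := rfl
  have hmono : Monotone g := monotone_nat_of_le_succ fun n => by
    rw [hg]; exact Finset.subset_insert _ _
  have hmem {m n : ℕ} (h : m < n) : next (g m) ∈ g n :=
    hmono (Nat.succ_le_of_lt h) (by rw [hg]; exact Finset.mem_insert_self _ _)
  have hinj : Function.Injective fun n => next (g n) := by
    intro m n hmn
    by_contra hne
    rcases lt_or_gt_of_ne hne with h | h
    · exact hnext (g n) (by rw [← show next (g m) = next (g n) from hmn]; exact hmem h)
    · exact hnext (g m) (by rw [show next (g m) = next (g n) from hmn]; exact hmem h)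
  have hlim : Tendsto (r ∘ fun n => next (g n)) atTop (𝓝 0) := by
    rw [← Nat.cofinite_eq_atTop]
    exact h0.comp hinj.tendsto_cofinite
  refine ⟨fun n => next (g n), ⟨hinj, fun y => ?_⟩, antitone_nat_of_succ_le fun n => ?_, hlim⟩
  -- An index `y` never picked would bound every picked value below by `r y > 0`, against the limit
  -- `0`.
  · by_contra! hy
    have hyg (n : ℕ) : y ∉ g n := by
      induction n with
      | zero => simp [g]
      | succ n ih =>
        rw [hg, Finset.mem_insert, not_or]
        exact ⟨(hy n).symm, ih⟩
    exact absurd (ge_of_tendsto' hlim fun n => hle (g n) y (hyg n)) (not_le.2 (hr y))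
  · refine hle (g n) _ fun h => hnext (g (n + 1)) (hmono (Nat.le_succ n) h)

end Sorting

/-! ### Hilbert-Schmidt bounds and compactness. -/

section HilbertSchmidt

variable {E : Type*} [NormedAddCommGroup E] [InnerProductSpace ℂ E]

/-- The sums `∑ ‖A x‖²` over finite orthonormal sets are bounded by `C`. -/
def HilbertSchmidtBound (A : E →L[ℂ] E) (C : ℝ) : Prop :=
  ∀ s : Finset E, Orthonormal ℂ ((↑) : s → E) → ∑ x ∈ s, ‖A x‖ ^ 2 ≤ C

/-- Choose a finite orthonormal set whose sum nearly attains the supremum. Adjoining a unit vector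
orthogonal to it can gain only little, so `A` is small on the orthogonal complement of its span and
is a norm limit of the finite-rank operators `A ∘ projection`. -/
theorem HilbertSchmidtBound.isCompactOperator [CompleteSpace E] {A : E →L[ℂ] E} {C : ℝ}
    (hA : HilbertSchmidtBound A C) : IsCompactOperator A := by
  classical
  suffices A ∈ closure {f : E →L[ℂ] E | IsCompactOperator f} by
    rwa [isClosed_setOfPred_isCompactOperator.closure_eq] at this
  rw [Metric.mem_closure_iff]
  intro ε hε
  set Q : Set ℝ := {t | ∃ s : Finset E, Orthonormal ℂ ((↑) : s → E) ∧ t = ∑ x ∈ s, ‖A x‖ ^ 2}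
  have hQne : Q.Nonempty := ⟨0, ∅, by simp, by simp⟩
  have hQb : BddAbove Q := ⟨C, by rintro t ⟨s, hs, rfl⟩; exact hA s hs⟩
  obtain ⟨t, ⟨s, hs, rfl⟩, hlt⟩ := exists_lt_of_lt_csSup hQne
    (show sSup Q - (ε / 2) ^ 2 < sSup Q by linarith [sq_pos_of_pos (half_pos hε)])
  let K : Submodule ℂ E := Submodule.span ℂ (s : Set E)
  have : FiniteDimensional ℂ K := FiniteDimensional.span_finset ℂ s
  have hunit (v : E) (hv : v ∈ Kᗮ) (hv1 : ‖v‖ = 1) : ‖A v‖ ≤ ε / 2 := by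
    have hvs : v ∉ s := fun h => by
      have := Submodule.inner_right_of_mem_orthogonal (Submodule.subset_span h) hv
      rw [inner_self_eq_norm_sq_to_K, hv1] at this
      simp at this
    have hins : Orthonormal ℂ (fun x : (insert v s : Finset E) => (x : E)) := by
      have hs' := orthonormal_subtype_iff_ite.1 hs
      refine orthonormal_subtype_iff_ite.2 fun x hx y hy => ?_
      rcases Finset.mem_insert.1 hx with hxv | hxs <;>
        rcases Finset.mem_insert.1 hy with hyv | hys
      · rw [hxv, hyv, inner_self_eq_norm_sq_to_K, hv1]; simp
      · rw [if_neg (by rw [hxv]; exact (ne_of_mem_of_not_mem hys hvs).symm), hxv]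
        exact Submodule.inner_left_of_mem_orthogonal (Submodule.subset_span hys) hv
      · rw [if_neg (by rw [hyv]; exact ne_of_mem_of_not_mem hxs hvs), hyv]
        exact Submodule.inner_right_of_mem_orthogonal (Submodule.subset_span hxs) hv
      · exact hs' x hxs y hys
    have hle : ∑ x ∈ insert v s, ‖A x‖ ^ 2 ≤ sSup Q := le_csSup hQb ⟨_, hins, rfl⟩
    rw [Finset.sum_insert hvs] at hle
    exact le_of_sq_le_sq (by linarith) (half_pos hε).le
  have hperp (v : E) (hv : v ∈ Kᗮ) : ‖A v‖ ≤ ε / 2 * ‖v‖ := by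
    rcases eq_or_ne v 0 with rfl | h0
    · simp
    have hn : ‖v‖ ≠ 0 := norm_ne_zero_iff.2 h0
    have := hunit ((‖v‖⁻¹ : ℂ) • v) (Submodule.smul_mem _ _ hv) (by
      rw [norm_smul]; simp [hn])
    rw [map_smul, norm_smul, norm_inv, Complex.norm_real, norm_norm] at this
    rwa [inv_mul_le_iff₀ (by positivity), mul_comm] at this
  refine ⟨A ∘L K.starProjection, ?_, ?_⟩
  · have h1 : IsCompactOperator K.orthogonalProjectionOnto :=
      isCompactOperator_of_locallyCompactSpace_dom K.orthogonalProjectionOnto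
    exact h1.clm_comp (A ∘L K.subtypeL)
  · rw [dist_eq_norm]
    refine lt_of_le_of_lt (ContinuousLinearMap.opNorm_le_bound _ (half_pos hε).le fun x => ?_)
      (half_lt_self hε)
    have : (A - A ∘L K.starProjection) x = A (x - K.starProjection x) := by simp
    rw [this]
    refine (hperp _ (Submodule.sub_starProjection_mem_orthogonal x)).trans ?_
    gcongr
    rw [← Submodule.starProjection_orthogonal_val]
    exact Submodule.norm_starProjection_apply_le _ _

/-- The bound makes the squared moduli of the eigenvalues summable over any orthonormal family of
eigenvectors. -/
theorem HilbertSchmidtBound.tendsto_eigenvalues {A : E →L[ℂ] E} {C : ℝ}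
    (hA : HilbertSchmidtBound A C) {ι : Type*} {e : ι → E} (he : Orthonormal ℂ e) {m : ι → ℂ}
    (hm : ∀ i, A (e i) = m i • e i) : Tendsto (fun i => ‖m i‖ ^ 2) cofinite (𝓝 0) := by
  classical
  refine (summable_of_sum_le (c := C) (fun i => by positivity) fun u => ?_).tendsto_cofinite_zero
  have hinj : Function.Injective e := he.linearIndependent.injective
  have := hA (u.image e) (by
    have h1 := he.toSubtypeRange
    refine orthonormal_subtype_iff_ite.2 fun x hx y hy => ?_
    obtain ⟨i, -, rfl⟩ := Finset.mem_image.1 hx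
    obtain ⟨j, -, rfl⟩ := Finset.mem_image.1 hy
    rw [orthonormal_iff_ite.1 he, hinj.eq_iff])
  rw [Finset.sum_image (hinj.injOn)] at this
  simpa [hm, norm_smul, he.1] using this

end HilbertSchmidt

/-! ### Spectral theorem for a compact operator whose adjoint is its product with an involution. -/

section JointEigenbasis

open Module.End

universe u

variable {E : Type u} [NormedAddCommGroup E] [InnerProductSpace ℂ E] [CompleteSpace E]

open scoped ComplexConjugate InnerProductSpace

/-- A compact operator `A` for which a self-adjoint involution `R` satisfies `A R = R A = A†` has
an orthonormal system of eigenvectors with dense span. -/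
theorem exists_orthonormal_eigenvectors (A R : E →L[ℂ] E) (hA : IsCompactOperator A)
    (hRs : R.IsSymmetric) (hRR : ∀ x, R (R x) = x) (hAR : ∀ x, A (R x) = R (A x))
    (hadj : ∀ x y, ⟪A x, y⟫_ℂ = ⟪x, A (R y)⟫_ℂ) :
    ∃ (ι : Type u) (e : ι → E) (m : ι → ℂ), Orthonormal ℂ e ∧ (∀ i, A (e i) = m i • e i) ∧
      (∀ i, A (R (e i)) = conj (m i) • e i) ∧
      (Submodule.span ℂ (Set.range e)).topologicalClosure = ⊤ := by
  -- Since `β` is the conjugate of `α` and `A† = A R`, the operator `H = α A + β A R` is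
  -- self-adjoint. As `α + β = 1` and `α - β = -i`, it equals `A` where `R = 1` and `-i A` where `R
  -- = -1`, so `A` is recovered from `H` and `R`.
  let α : ℂ := (1 - Complex.I) / 2
  let β : ℂ := (1 + Complex.I) / 2
  have hαβ : conj α = β := by simp [α, β, sub_eq_add_neg, Complex.conj_ofNat]
  have hβα : conj β = α := by simp [α, β, sub_eq_add_neg, Complex.conj_ofNat]
  let H : E →L[ℂ] E := α • A + β • (A ∘L R)
  have hHx (x : E) : H x = α • A x + β • A (R x) := rfl
  have hHc : IsCompactOperator H := (hA.smul α).add ((hA.comp_clm R).smul β)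
  have hadj' (x y : E) : ⟪A (R x), y⟫_ℂ = ⟪x, A y⟫_ℂ := by
    rw [hadj, hAR]
    exact (hRs x (R (A y))).trans (by rw [ContinuousLinearMap.coe_coe, hRR])
  have hHs : H.IsSymmetric := by
    intro x y
    change ⟪H x, y⟫_ℂ = ⟪x, H y⟫_ℂ
    rw [hHx, hHx, inner_add_left, inner_add_right, inner_smul_left, inner_smul_left,
      inner_smul_right, inner_smul_right, hadj, hadj', hαβ, hβα, add_comm]
  have hHR (x : E) : H (R x) = R (H x) := by simp [hHx, hAR]
  let G : ℂ × ℂ → Submodule ℂ E := fun i =>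
    eigenspace (H : Module.End ℂ E) i.2 ⊓ eigenspace (R : Module.End ℂ E) i.1
  have hGmem (i : ℂ × ℂ) (x : E) : x ∈ G i ↔ H x = i.2 • x ∧ R x = i.1 • x := by
    simp [G]
  have hGo : OrthogonalFamily ℂ (fun i => G i) fun i => (G i).subtypeₗᵢ :=
    LinearMap.IsSymmetric.orthogonalFamily_eigenspace_inf_eigenspace hHs hRs
  have hGc (i : ℂ × ℂ) : IsClosed (G i : Set E) := by
    have : (G i : Set E) = {x | H x = i.2 • x} ∩ {x | R x = i.1 • x} := by
      ext x; simp only [SetLike.mem_coe, hGmem]; rfl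
    rw [this]
    exact (isClosed_eq (by fun_prop) (by fun_prop)).inter (isClosed_eq (by fun_prop) (by fun_prop))
  have (i : ℂ × ℂ) : CompleteSpace (G i) := (hGc i).completeSpace_coe
  choose w b hb using fun i => exists_hilbertBasis ℂ (G i)
  let e : (Σ i, w i) → E := fun a => ((b a.1 a.2 : G a.1) : E)
  have heo : Orthonormal ℂ e := hGo.orthonormal_sigma_orthonormal fun i => (b i).orthonormal
  have heG (a : Σ i, w i) : e a ∈ G a.1 := (b a.1 a.2).2
  have hpm (a : Σ i, w i) : a.1.1 = 1 ∨ a.1.1 = -1 := by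
    have h2 := ((hGmem _ _).1 (heG a)).2
    have h3 : (a.1.1 * a.1.1) • e a = (1 : ℂ) • e a := by
      rw [mul_smul, ← h2, ← map_smul, ← h2, hRR, one_smul]
    exact mul_self_eq_one_iff.1 (smul_left_injective ℂ (heo.ne_zero a) h3)
  -- On even vectors `A = H`; on odd vectors `A = i H`.
  let m : (Σ i, w i) → ℂ := fun a => if a.1.1 = 1 then a.1.2 else Complex.I * a.1.2
  have hm (a : Σ i, w i) : A (e a) = m a • e a := by
    obtain ⟨h1, h2⟩ := (hGmem _ _).1 (heG a)
    simp only [m]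
    rcases hpm a with h5 | h5
    · rw [if_pos h5, ← h1, hHx, h2, h5, one_smul, ← add_smul,
        show α + β = 1 by simp only [α, β]; ring, one_smul]
    · rw [if_neg (by rw [h5]; norm_num), mul_smul, ← h1, hHx, h2, h5, map_smul, smul_smul,
        ← add_smul, smul_smul, show Complex.I * (α + β * -1) = 1 by
          simp only [α, β]; linear_combination -Complex.I_mul_I, one_smul]
  have hmR (a : Σ i, w i) : A (R (e a)) = conj (m a) • e a := by
    have h1 : A (R (e a)) = (a.1.1 * m a) • e a := by
      rw [((hGmem _ _).1 (heG a)).2, map_smul, hm, smul_smul]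
    -- Both sides of `⟪A e, e⟫ = ⟪e, A R e⟫` are computed: the left one is `conj m`, the right one
    -- `r m` with `R e = r e`.
    have h2 := hadj (e a) (e a)
    rw [h1, hm, inner_smul_left, inner_smul_right, inner_self_eq_norm_sq_to_K, heo.1] at h2
    rw [h1]
    congr 1
    simpa using h2.symm
  refine ⟨_, e, m, heo, hm, hmR, ?_⟩
  · set M := (Submodule.span ℂ (Set.range e)).topologicalClosure
    have hM : IsClosed (M : Set E) := Submodule.isClosed_topologicalClosure _
    have hGM (i : ℂ × ℂ) : G i ≤ M := by
      have h1 : (Submodule.span ℂ (Set.range (b i))).topologicalClosure ≤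
          M.comap (G i).subtype := by
        refine Submodule.topologicalClosure_minimal _ (Submodule.span_le.2 ?_)
          (hM.preimage continuous_subtype_val)
        rintro _ ⟨j, rfl⟩
        exact Submodule.le_topologicalClosure _ (Submodule.subset_span ⟨⟨i, j⟩, rfl⟩)
      rw [(b i).dense_span] at h1
      exact fun x hx => h1 (show (⟨x, hx⟩ : G i) ∈ ⊤ from trivial)
    -- `H` commutes with `R`, so the even and odd parts of an eigenvector of `H` lie in joint
    -- eigenspaces.
    have hEM (h : ℂ) : eigenspace (H : Module.End ℂ E) h ≤ M := by
      intro x hx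
      have hx' : H x = h • x := Module.End.mem_eigenspace_iff.1 hx
      have h1 : x + R x ∈ M := hGM (1, h) ((hGmem _ _).2 ⟨by
        rw [map_add, hHR, hx', map_smul, smul_add], by rw [map_add, hRR, one_smul, add_comm]⟩)
      have h2 : x - R x ∈ M := hGM (-1, h) ((hGmem _ _).2 ⟨by
        rw [map_sub, hHR, hx', map_smul, smul_sub], by
        rw [map_sub, hRR, neg_one_smul, neg_sub]⟩)
      have h3 : x = (1 / 2 : ℂ) • ((x + R x) + (x - R x)) := by
        rw [add_add_sub_cancel, ← two_smul ℂ x, smul_smul]; norm_num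
      rw [h3]
      exact M.smul_mem _ (M.add_mem h1 h2)
    have hbot := ContinuousLinearMap.orthogonalComplement_iSup_eigenspaces_eq_bot hHc hHs
    have : M.topologicalClosure = ⊤ := by
      rw [Submodule.topologicalClosure_eq_top_iff, eq_bot_iff, ← hbot]
      exact Submodule.orthogonal_le (iSup_le hEM)
    rwa [hM.submodule_topologicalClosure_eq] at this

end JointEigenbasis

end QPSWF

namespace QPSWF

/-! ### Agreement of the `L²` Fourier transform with the Fourier integral. -/

section FourierL2

open FourierTransform
open scoped ContDiff SchwartzMap

variable {V : Type*} [NormedAddCommGroup V] [InnerProductSpace ℝ V] [FiniteDimensional ℝ V]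
  [MeasurableSpace V] [BorelSpace V]

theorem continuous_fourier {f : V → ℂ} (hf : Integrable f) : Continuous (𝓕 f) :=
  VectorFourier.fourierIntegral_continuous Real.continuous_fourierChar
    (innerSL ℝ).continuous₂ hf

theorem continuous_fourierInv {f : V → ℂ} (hf : Integrable f) : Continuous (𝓕⁻ f) := by
  rw [show 𝓕⁻ f = fun x => 𝓕 f (-x) from funext (Real.fourierInv_eq_fourier_neg f)]
  exact (continuous_fourier hf).comp continuous_neg

/-- On `L¹ ∩ L²` the `L²` Fourier transform is given by the Fourier integral. -/
theorem coeFn_fourier_toLp {f : V → ℂ} (h1 : Integrable f) (h2 : MemLp f 2) :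
    ((𝓕 (h2.toLp f) : Lp ℂ 2 (volume : Measure V)) : V → ℂ) =ᵐ[volume] 𝓕 f := by
  -- Both sides are tested against smooth compactly supported functions; the transform is moved to
  -- the test function, as a tempered distribution on one side and by Fubini on the other.
  refine ae_eq_of_integral_contDiff_smul_eq
    ((Lp.memLp _).locallyIntegrable one_le_two)
    (continuous_fourier h1).locallyIntegrable fun g g_smooth g_cpt => ?_
  have hg₁ : HasCompactSupport (Complex.ofRealCLM ∘ g) := g_cpt.comp_left rfl
  have hg₂ : ContDiff ℝ ∞ (Complex.ofRealCLM ∘ g) := by fun_prop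
  set φ : 𝓢(V, ℂ) := hg₁.toSchwartzMap hg₂
  have hφ (x : V) (z : ℂ) : g x • z = φ x • z := by simp [φ]
  simp_rw [hφ]
  rw [← Lp.toTemperedDistribution_apply, ← Lp.fourier_toTemperedDistribution_eq,
    TemperedDistribution.fourier_apply, Lp.toTemperedDistribution_apply]
  have h3 : ∫ x, (𝓕 φ) x • (h2.toLp f) x = ∫ x, (𝓕 (φ : V → ℂ)) x • f x := by
    refine integral_congr_ae ?_
    filter_upwards [h2.coeFn_toLp] with x hx
    rw [hx, SchwartzMap.fourier_coe]
  rw [h3]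
  refine (VectorFourier.integral_fourierIntegral_smul_eq_flip Real.continuous_fourierChar
    (innerSL ℝ).continuous₂ φ.integrable h1).trans ?_
  refine integral_congr_ae (ae_of_all _ fun x => ?_)
  change φ x • VectorFourier.fourierIntegral _ _ (innerₗ V).flip f x =
    φ x • VectorFourier.fourierIntegral _ _ (innerₗ V) f x
  rw [flip_innerₗ]

/-- On `L¹ ∩ L²` the inverse `L²` Fourier transform is given by the inverse Fourier integral. -/
theorem coeFn_fourierInv_toLp {f : V → ℂ} (h1 : Integrable f) (h2 : MemLp f 2) :
    ((𝓕⁻ (h2.toLp f) : Lp ℂ 2 (volume : Measure V)) : V → ℂ) =ᵐ[volume] 𝓕⁻ f := by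
  refine ae_eq_of_integral_contDiff_smul_eq
    ((Lp.memLp _).locallyIntegrable one_le_two)
    (continuous_fourierInv h1).locallyIntegrable fun g g_smooth g_cpt => ?_
  have hg₁ : HasCompactSupport (Complex.ofRealCLM ∘ g) := g_cpt.comp_left rfl
  have hg₂ : ContDiff ℝ ∞ (Complex.ofRealCLM ∘ g) := by fun_prop
  set φ : 𝓢(V, ℂ) := hg₁.toSchwartzMap hg₂
  have hφ (x : V) (z : ℂ) : g x • z = φ x • z := by simp [φ]
  simp_rw [hφ]
  rw [← Lp.toTemperedDistribution_apply, ← Lp.fourierInv_toTemperedDistribution_eq,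
    TemperedDistribution.fourierInv_apply, Lp.toTemperedDistribution_apply]
  have h3 : ∫ x, (𝓕⁻ φ) x • (h2.toLp f) x = ∫ x, (𝓕⁻ (φ : V → ℂ)) x • f x := by
    refine integral_congr_ae ?_
    filter_upwards [h2.coeFn_toLp] with x hx
    rw [hx, SchwartzMap.fourierInv_coe]
  rw [h3]
  have hL : Continuous fun p : V × V => (-innerₗ V : V →ₗ[ℝ] V →ₗ[ℝ] ℝ) p.1 p.2 :=
    (innerSL ℝ).continuous₂.neg
  refine (VectorFourier.integral_fourierIntegral_smul_eq_flip Real.continuous_fourierChar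
    hL φ.integrable h1).trans ?_
  refine integral_congr_ae (ae_of_all _ fun x => ?_)
  change φ x • VectorFourier.fourierIntegral _ _ (-innerₗ V).flip f x =
    φ x • VectorFourier.fourierIntegral _ _ (-innerₗ V) f x
  rw [show (-innerₗ V).flip = -innerₗ V from
    LinearMap.ext₂ fun a b => by simp [real_inner_comm]]

end FourierL2

/-! ### Unitary dilations of the plane. -/

section Dilation

theorem map_smul_volume_prod {s : ℝ} (hs : s ≠ 0) :
    Measure.map (fun z : ℝ × ℝ => s • z) volume = ENNReal.ofReal ((s ^ 2)⁻¹) • volume := by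
  rw [Measure.map_addHaar_smul volume hs, Module.finrank_prod, Module.finrank_self,
    one_add_one_eq_two,
    abs_of_nonneg (inv_nonneg.2 (even_two.pow_nonneg s))]

theorem quasiMeasurePreserving_smul_prod {s : ℝ} (hs : s ≠ 0) :
    Measure.QuasiMeasurePreserving (fun z : ℝ × ℝ => s • z) volume volume :=
  ⟨by fun_prop, by rw [map_smul_volume_prod hs]; exact Measure.smul_absolutelyContinuous⟩

/-- The `L²`-normalised dilation of a function on the plane. -/
noncomputable def dilate (s : ℝ) (f : ℝ × ℝ → ℂ) (z : ℝ × ℝ) : ℂ := (|s| : ℝ) * f (s • z)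

theorem eLpNorm_dilate {s : ℝ} (hs : s ≠ 0) (f : ℝ × ℝ → ℂ) :
    eLpNorm (dilate s f) 2 volume = eLpNorm f 2 volume := by
  have h1 : dilate s f = ((|s| : ℝ) : ℂ) • (f ∘ fun z : ℝ × ℝ => s • z) := rfl
  have hemb : MeasurableEmbedding fun z : ℝ × ℝ => s • z :=
    (Homeomorph.smulOfNeZero s hs).measurableEmbedding
  rw [h1, eLpNorm_const_smul, ← hemb.eLpNorm_map_measure, map_smul_volume_prod hs,
    eLpNorm_smul_measure_of_ne_top (by simp), smul_eq_mul, ← mul_assoc]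
  have h2 : ‖((|s| : ℝ) : ℂ)‖ₑ * ENNReal.ofReal ((s ^ 2)⁻¹) ^ (1 / (2 : ENNReal)).toReal = 1 := by
    rw [ENNReal.ofReal_rpow_of_nonneg (by positivity) (by simp), ← ofReal_norm,
      ← ENNReal.ofReal_mul (norm_nonneg _)]
    have : (1 / (2 : ENNReal)).toReal = 1 / 2 := by simp
    rw [this, ← Real.sqrt_eq_rpow, Real.sqrt_inv, Real.sqrt_sq_eq_abs]
    simp [hs]
  rw [h2, one_mul]

theorem memLp_dilate {s : ℝ} (hs : s ≠ 0) {f : ℝ × ℝ → ℂ} (hf : MemLp f 2) :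
    MemLp (dilate s f) 2 :=
  ⟨(hf.1.comp_quasiMeasurePreserving (quasiMeasurePreserving_smul_prod hs)).const_mul _,
    by rw [eLpNorm_dilate hs]; exact hf.2⟩

theorem dilate_congr {s : ℝ} (hs : s ≠ 0) {f g : ℝ × ℝ → ℂ} (h : f =ᵐ[volume] g) :
    dilate s f =ᵐ[volume] dilate s g := by
  filter_upwards [(quasiMeasurePreserving_smul_prod hs).ae_eq_comp h] with z hz
  simp only [dilate, Function.comp_apply] at hz ⊢
  rw [hz]

theorem dilate_dilate (s t : ℝ) (f : ℝ × ℝ → ℂ) : dilate s (dilate t f) = dilate (t * s) f := by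
  ext z; simp [dilate, smul_smul, abs_mul]; ring

theorem dilate_one (f : ℝ × ℝ → ℂ) : dilate 1 f = f := by
  ext z; simp [dilate]

/-- Dilation as an isometry of `L²(ℝ²)`. -/
noncomputable def dilateₗᵢ (s : ℝ) (hs : s ≠ 0) :
    Lp ℂ 2 (volume : Measure (ℝ × ℝ)) →ₗᵢ[ℂ] Lp ℂ 2 (volume : Measure (ℝ × ℝ)) where
  toFun f := (memLp_dilate hs (Lp.memLp f)).toLp _
  map_add' f g := by
    rw [← MemLp.toLp_add, MemLp.toLp_eq_toLp_iff]
    filter_upwards [dilate_congr hs (Lp.coeFn_add f g)] with z hz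
    rw [hz]; simp [dilate, mul_add]
  map_smul' a f := by
    rw [RingHom.id_apply, ← MemLp.toLp_const_smul, MemLp.toLp_eq_toLp_iff]
    filter_upwards [dilate_congr hs (Lp.coeFn_smul a f)] with z hz
    rw [hz]; simp [dilate]; ring
  norm_map' f := by
    change ‖(memLp_dilate hs (Lp.memLp f)).toLp _‖ = ‖f‖
    rw [Lp.norm_toLp, eLpNorm_dilate hs, Lp.norm_def]

theorem coeFn_dilateₗᵢ {s : ℝ} (hs : s ≠ 0) (f : Lp ℂ 2 (volume : Measure (ℝ × ℝ))) :
    dilateₗᵢ s hs f =ᵐ[volume] dilate s f :=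
  (memLp_dilate hs (Lp.memLp f)).coeFn_toLp

theorem dilateₗᵢ_inv_apply {s : ℝ} (hs : s ≠ 0) (f : Lp ℂ 2 (volume : Measure (ℝ × ℝ))) :
    dilateₗᵢ s hs (dilateₗᵢ s⁻¹ (inv_ne_zero hs) f) = f := by
  ext1
  filter_upwards [coeFn_dilateₗᵢ hs (dilateₗᵢ s⁻¹ (inv_ne_zero hs) f),
    dilate_congr hs (coeFn_dilateₗᵢ (inv_ne_zero hs) f)] with z h1 h2
  rw [h1, h2, dilate_dilate, inv_mul_cancel₀ hs, dilate_one]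

/-- Dilation as a unitary operator on `L²(ℝ²)`. -/
noncomputable def dilateEquiv (s : ℝ) (hs : s ≠ 0) :
    Lp ℂ 2 (volume : Measure (ℝ × ℝ)) ≃ₗᵢ[ℂ] Lp ℂ 2 (volume : Measure (ℝ × ℝ)) :=
  LinearIsometryEquiv.ofLinearIsometry (dilateₗᵢ s hs)
    (dilateₗᵢ s⁻¹ (inv_ne_zero hs)).toLinearMap
    (LinearMap.ext fun f => dilateₗᵢ_inv_apply hs f)
    (LinearMap.ext fun f => by
      have := dilateₗᵢ_inv_apply (inv_ne_zero hs) f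
      simp only [inv_inv] at this
      exact this)

end Dilation

/-! ### The unitary Fourier transform with frequency scale `a`. -/

section PlaneFourier

open FourierTransform

/-- The oscillating kernel `exp(i a z·p)` on the plane. -/
noncomputable def osc (a : ℝ) (z p : ℝ × ℝ) : ℂ :=
  Complex.exp ((a * (z.1 * p.1 + z.2 * p.2) : ℝ) * Complex.I)

/-- The integral `∫ exp(i a z·p) f(p) dp` over the plane. -/
noncomputable def oscInt (a : ℝ) (f : ℝ × ℝ → ℂ) (z : ℝ × ℝ) : ℂ := ∫ p, osc a z p * f p

/-- `ℝ × ℝ` carries the sup norm, while the `L²` Fourier transform needs an inner product; the two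
planes are identified by a measure-preserving map. -/
abbrev Plane := WithLp 2 (ℝ × ℝ)

noncomputable def planeEquiv :
    Lp ℂ 2 (volume : Measure Plane) ≃ₗᵢ[ℂ] Lp ℂ 2 (volume : Measure (ℝ × ℝ)) :=
  LinearIsometryEquiv.ofLinearIsometry
    (Lp.compMeasurePreservingₗᵢ ℂ _ (WithLp.volume_preserving_toLp ℝ ℝ))
    (Lp.compMeasurePreservingₗ ℂ _ (WithLp.volume_preserving_ofLp ℝ ℝ))
    (LinearMap.ext fun f =>
      (Lp.compMeasurePreserving_comp_apply f (WithLp.volume_preserving_ofLp ℝ ℝ)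
        (WithLp.volume_preserving_toLp ℝ ℝ)).symm.trans (Lp.compMeasurePreserving_id_apply f))
    (LinearMap.ext fun f =>
      (Lp.compMeasurePreserving_comp_apply f (WithLp.volume_preserving_toLp ℝ ℝ)
        (WithLp.volume_preserving_ofLp ℝ ℝ)).symm.trans (Lp.compMeasurePreserving_id_apply f))

theorem coeFn_planeEquiv (f : Lp ℂ 2 (volume : Measure Plane)) :
    planeEquiv f =ᵐ[volume] fun z => f (WithLp.toLp 2 z) :=
  Lp.coeFn_compMeasurePreserving f (WithLp.volume_preserving_toLp ℝ ℝ)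

theorem fourier_comp_ofLp (f : ℝ × ℝ → ℂ) (w : Plane) :
    𝓕 (f ∘ WithLp.ofLp : Plane → ℂ) w = oscInt (-(2 * Real.pi)) f w.ofLp := by
  rw [Real.fourier_eq', oscInt,
    ← (WithLp.volume_preserving_ofLp ℝ ℝ).integral_comp (MeasurableEquiv.toLp 2 _).symm.measurableEmbedding]
  simp only [osc, WithLp.prod_inner_apply, Function.comp_apply, smul_eq_mul]
  congr! 6
  simp

theorem fourierInv_comp_ofLp (f : ℝ × ℝ → ℂ) (w : Plane) :
    𝓕⁻ (f ∘ WithLp.ofLp : Plane → ℂ) w = oscInt (2 * Real.pi) f w.ofLp := by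
  rw [Real.fourierInv_eq', oscInt,
    ← (WithLp.volume_preserving_ofLp ℝ ℝ).integral_comp (MeasurableEquiv.toLp 2 _).symm.measurableEmbedding]
  simp only [osc, WithLp.prod_inner_apply, Function.comp_apply, smul_eq_mul]
  congr! 6

/-- The unitary Fourier transform `f ↦ (|a|/2π) ∫ exp(i a z·p) f(p) dp` on `L²(ℝ²)`. -/
noncomputable def planeFourier (a : ℝ) (ha : a ≠ 0) :
    Lp ℂ 2 (volume : Measure (ℝ × ℝ)) ≃ₗᵢ[ℂ] Lp ℂ 2 (volume : Measure (ℝ × ℝ)) :=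
  ((planeEquiv.symm.trans (Lp.fourierTransformₗᵢ Plane ℂ)).trans planeEquiv).trans
    -- The standard kernel is `exp(-2πi z·p)`; replacing `z` by `-(a/2π) z` turns it into `exp(i a
    -- z·p)`, and the `L²` normalisation of the dilation supplies `|a|/2π`.
    (dilateEquiv (-(a / (2 * Real.pi))) (neg_ne_zero.2 (div_ne_zero ha Real.two_pi_pos.ne')))

theorem oscInt_smul (a s : ℝ) (f : ℝ × ℝ → ℂ) (z : ℝ × ℝ) :
    oscInt a f (s • z) = oscInt (a * s) f z := by
  simp only [oscInt, osc, Prod.smul_fst, Prod.smul_snd, smul_eq_mul]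
  congr! 6
  ring

theorem oscInt_dilate {a s : ℝ} (hs : s ≠ 0) (f : ℝ × ℝ → ℂ) (z : ℝ × ℝ) :
    oscInt a (dilate s f) z = (|s|⁻¹ : ℝ) * oscInt (a / s) f z := by
  have h1 (p : ℝ × ℝ) : osc a z p * dilate s f p =
      (|s| : ℝ) * (fun q => osc (a / s) z q * f q) (s • p) := by
    have : osc (a / s) z (s • p) = osc a z p := by
      simp only [osc, Prod.smul_fst, Prod.smul_snd, smul_eq_mul]
      congr! 3
      field_simp
    simp only [this, dilate]
    ring
  simp only [oscInt, h1]
  rw [integral_const_mul,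
    Measure.integral_comp_smul volume (fun q => osc (a / s) z q * f q) s, Module.finrank_prod, Module.finrank_self,
    one_add_one_eq_two, abs_inv, abs_pow, Complex.real_smul, ← mul_assoc, ← Complex.ofReal_mul]
  congr 2
  have := abs_ne_zero.2 hs
  field_simp

theorem planeFourier_toLp {a : ℝ} (ha : a ≠ 0) {f : ℝ × ℝ → ℂ} (h1 : Integrable f)
    (h2 : MemLp f 2) :
    planeFourier a ha (h2.toLp f) =ᵐ[volume] fun z => (|a| / (2 * Real.pi) : ℝ) * oscInt a f z := by
  have hs : -(a / (2 * Real.pi)) ≠ 0 := neg_ne_zero.2 (div_ne_zero ha Real.two_pi_pos.ne')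
  have h1' : Integrable (f ∘ WithLp.ofLp : Plane → ℂ) :=
    (WithLp.volume_preserving_ofLp ℝ ℝ).integrable_comp_of_integrable h1
  have h3 := dilate_congr hs ((coeFn_planeEquiv _).trans
    ((WithLp.volume_preserving_toLp ℝ ℝ).quasiMeasurePreserving.ae_eq_comp (coeFn_fourier_toLp h1'
      (h2.comp_measurePreserving (WithLp.volume_preserving_ofLp ℝ ℝ)))))
  refine (coeFn_dilateₗᵢ hs _).trans (h3.trans (ae_of_all _ fun z => ?_))
  simp only [dilate, Function.comp_apply, fourier_comp_ofLp, oscInt_smul]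
  rw [abs_neg, abs_div, abs_of_pos Real.two_pi_pos]
  congr 2
  field_simp

theorem planeFourier_symm_toLp {a : ℝ} (ha : a ≠ 0) {f : ℝ × ℝ → ℂ} (h1 : Integrable f)
    (h2 : MemLp f 2) :
    (planeFourier a ha).symm (h2.toLp f) =ᵐ[volume]
      fun z => (|a| / (2 * Real.pi) : ℝ) * oscInt (-a) f z := by
  have hs : -(a / (2 * Real.pi)) ≠ 0 := neg_ne_zero.2 (div_ne_zero ha Real.two_pi_pos.ne')
  have hs' := inv_ne_zero hs
  have h4 : dilateₗᵢ _ hs' (h2.toLp f) = (memLp_dilate hs' h2).toLp _ := by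
    ext1
    exact (coeFn_dilateₗᵢ hs' _).trans
      ((dilate_congr hs' h2.coeFn_toLp).trans (MemLp.coeFn_toLp _).symm)
  have h1' : Integrable (dilate (-(a / (2 * Real.pi)))⁻¹ f ∘ WithLp.ofLp : Plane → ℂ) :=
    (WithLp.volume_preserving_ofLp ℝ ℝ).integrable_comp_of_integrable
      ((h1.comp_smul hs').const_mul _)
  have h5 : (planeFourier a ha).symm (h2.toLp f) = planeEquiv (𝓕⁻ (planeEquiv.symm
      ((memLp_dilate hs' h2).toLp _))) := by
    rw [← h4]; rfl
  rw [h5]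
  refine (coeFn_planeEquiv _).trans
    (((WithLp.volume_preserving_toLp ℝ ℝ).quasiMeasurePreserving.ae_eq_comp (coeFn_fourierInv_toLp
      h1' ((memLp_dilate hs' h2).comp_measurePreserving
        (WithLp.volume_preserving_ofLp ℝ ℝ)))).trans (ae_of_all _ fun z => ?_))
  simp only [Function.comp_apply, fourierInv_comp_ofLp, oscInt_dilate hs']
  rw [abs_inv, inv_inv, abs_neg, abs_div, abs_of_pos Real.two_pi_pos]
  congr 2
  field_simp

end PlaneFourier

end QPSWF

namespace QPSWF

/-! ### Oscillatory integrals and unique continuation. -/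

section OscInt

theorem norm_osc (a : ℝ) (z p : ℝ × ℝ) : ‖osc a z p‖ = 1 :=
  Complex.norm_exp_ofReal_mul_I _

theorem continuous_osc (a : ℝ) : Continuous fun w : (ℝ × ℝ) × (ℝ × ℝ) => osc a w.1 w.2 := by
  unfold osc; fun_prop

theorem continuous_osc_left (a : ℝ) (p : ℝ × ℝ) : Continuous fun z => osc a z p := by
  unfold osc; fun_prop

theorem continuous_osc_right (a : ℝ) (z : ℝ × ℝ) : Continuous (osc a z) := by
  unfold osc; fun_prop

theorem osc_comm (a : ℝ) (z p : ℝ × ℝ) : osc a z p = osc a p z := by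
  simp only [osc]; congr! 3; ring

theorem conj_osc (a : ℝ) (z p : ℝ × ℝ) : starRingEnd ℂ (osc a z p) = osc (-a) z p := by
  simp only [osc, ← Complex.exp_conj, map_mul, Complex.conj_ofReal, Complex.conj_I]
  congr 1; push_cast; ring

theorem osc_neg_left (a : ℝ) (z p : ℝ × ℝ) : osc a (-z) p = osc (-a) z p := by
  simp only [osc, Prod.fst_neg, Prod.snd_neg]; congr! 3; ring

theorem osc_neg_right (a : ℝ) (z p : ℝ × ℝ) : osc a z (-p) = osc (-a) z p := by
  rw [osc_comm, osc_neg_left, osc_comm]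

theorem integrable_osc_mul (a : ℝ) (z : ℝ × ℝ) {μ : Measure (ℝ × ℝ)} {f : ℝ × ℝ → ℂ}
    (hf : Integrable f μ) : Integrable (fun p => osc a z p * f p) μ :=
  hf.bdd_mul (continuous_osc_right a z).aestronglyMeasurable
    (ae_of_all _ fun p => (norm_osc a z p).le)

theorem continuous_oscInt (a : ℝ) {f : ℝ × ℝ → ℂ} (hf : Integrable f) :
    Continuous (oscInt a f) := by
  refine continuous_of_dominated (fun z => (integrable_osc_mul a z hf).1)
    (fun z => ae_of_all _ fun p => ?_) hf.norm
    (ae_of_all _ fun p => (continuous_osc_left a p).mul continuous_const)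
  rw [norm_mul, norm_osc, one_mul]

theorem oscInt_neg (a : ℝ) (f : ℝ × ℝ → ℂ) (z : ℝ × ℝ) : oscInt a f (-z) = oscInt (-a) f z := by
  simp only [oscInt, osc_neg_left]

theorem oscInt_indicator (a : ℝ) {S : Set (ℝ × ℝ)} (hS : MeasurableSet S) (f : ℝ × ℝ → ℂ)
    (z : ℝ × ℝ) : oscInt a (S.indicator f) z = ∫ p in S, osc a z p * f p := by
  rw [oscInt, ← integral_indicator hS]
  congr with p
  by_cases hp : p ∈ S <;> simp [hp]

/-- The oscillatory integral of a compactly supported function vanishes identically as soon as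
it vanishes on a nonempty open set. -/
theorem oscInt_eq_zero_of_eqOn_open (a : ℝ) {K : Set (ℝ × ℝ)} (hK : Bornology.IsBounded K)
    {g : ℝ × ℝ → ℂ} (hg : Integrable g) (hgK : ∀ p, p ∉ K → g p = 0) {U : Set (ℝ × ℝ)}
    (hU : IsOpen U) (hne : U.Nonempty) (h0 : ∀ z ∈ U, oscInt a g z = 0) (z : ℝ × ℝ) :
    oscInt a g z = 0 := by
  obtain ⟨z₀, hz₀⟩ := hne
  -- The integral is restricted to the line `z₀ + t d` and extended to complex `t = ζ`. Compact
  -- support makes it entire in `ζ`; it vanishes for small real `t`, hence everywhere, and `ζ = 1`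
  -- gives the point `z`.
  set d : ℝ × ℝ := z - z₀
  let ℓ : ℝ × ℝ → ℝ := fun p => a * (d.1 * p.1 + d.2 * p.2)
  have hℓc : Continuous ℓ := by fun_prop
  obtain ⟨B, hB⟩ : ∃ B, ∀ p ∈ K, |ℓ p| ≤ B := by
    obtain ⟨B, hB⟩ := (hK.isCompact_closure.image hℓc).isBounded.exists_norm_le
    exact ⟨B, fun p hp => hB _ ⟨p, subset_closure hp, rfl⟩⟩
  let F : ℂ → ℝ × ℝ → ℂ := fun ζ p => Complex.exp (ζ * (ℓ p * Complex.I)) * (osc a z₀ p * g p)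
  let F' : ℂ → ℝ × ℝ → ℂ := fun ζ p => (ℓ p * Complex.I) * F ζ p
  have hmeas (ζ : ℂ) : AEStronglyMeasurable (F ζ) volume :=
    (Continuous.aestronglyMeasurable (by fun_prop)).mul (integrable_osc_mul a z₀ hg).1
  have hFK (ζ : ℂ) (p : ℝ × ℝ) (hp : p ∉ K) : F ζ p = 0 := by simp [F, hgK p hp]
  have hFb (ζ : ℂ) (p : ℝ × ℝ) : ‖F ζ p‖ ≤ Real.exp (‖ζ‖ * |B|) * ‖g p‖ := by
    by_cases hp : p ∈ K
    · simp only [F]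
      rw [norm_mul, norm_mul, norm_osc, one_mul, Complex.norm_exp]
      gcongr
      refine (Complex.re_le_norm _).trans ?_
      rw [norm_mul, norm_mul, Complex.norm_I, mul_one, Complex.norm_real]
      gcongr
      exact (hB p hp).trans (le_abs_self B)
    · rw [hFK ζ p hp, norm_zero]; positivity
  have hd : Differentiable ℂ fun ζ => ∫ p, F ζ p := by
    intro ζ
    refine (hasDerivAt_integral_of_dominated_loc_of_deriv_le (F' := F') (s := Metric.ball ζ 1)
      (bound := fun p => |B| * (Real.exp ((‖ζ‖ + 1) * |B|) * ‖g p‖))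
      (Metric.ball_mem_nhds ζ one_pos) (Eventually.of_forall hmeas) ?_ ?_ ?_ ?_ ?_).2.differentiableAt
    · exact (hg.norm.const_mul _).mono' (hmeas ζ) (ae_of_all _ (hFb ζ))
    · exact (Continuous.aestronglyMeasurable (by fun_prop)).mul (hmeas ζ)
    · refine ae_of_all _ fun p ξ hξ => ?_
      by_cases hp : p ∈ K
      · simp only [F']
        rw [norm_mul, norm_mul, Complex.norm_I, mul_one, Complex.norm_real]
        have hξ' : ‖ξ‖ ≤ ‖ζ‖ + 1 := by
          have := norm_sub_norm_le ξ ζ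
          rw [Metric.mem_ball, dist_eq_norm] at hξ
          linarith
        gcongr
        · exact (hB p hp).trans (le_abs_self B)
        · exact (hFb ξ p).trans (by gcongr)
      · simp only [F', hFK ξ p hp, mul_zero, norm_zero]; positivity
    · exact (hg.norm.const_mul _).const_mul _
    · refine ae_of_all _ fun p ξ _ => ?_
      have := (((hasDerivAt_id ξ).mul_const (ℓ p * Complex.I : ℂ)).cexp).mul_const
        (osc a z₀ p * g p)
      convert! this using 1
      simp only [F', F, id_eq]
      ring
  have hFr (t : ℝ) : ∫ p, F t p = oscInt a g (z₀ + t • d) := by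
    refine integral_congr_ae (ae_of_all _ fun p => ?_)
    simp only [F, osc, ← mul_assoc, ← Complex.exp_add, ℓ]
    congr 2
    simp only [Prod.fst_add, Prod.snd_add, Prod.smul_fst, Prod.smul_snd, smul_eq_mul]
    push_cast; ring
  have han : AnalyticOnNhd ℂ (fun ζ => ∫ p, F ζ p) Set.univ := fun ζ _ => hd.analyticAt ζ
  have hev : ∀ᶠ t : ℝ in 𝓝[≠] 0, ∫ p, F t p = 0 := by
    have hc : Continuous fun t : ℝ => z₀ + t • d := by fun_prop
    have : ∀ᶠ t : ℝ in 𝓝 0, z₀ + t • d ∈ U :=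
      hc.continuousAt.eventually_mem (hU.mem_nhds (by simpa using hz₀))
    filter_upwards [nhdsWithin_le_nhds this] with t ht
    rw [hFr, h0 _ ht]
  have hmap : Tendsto (fun t : ℝ => (t : ℂ)) (𝓝[≠] 0) (𝓝[≠] 0) := by
    refine tendsto_nhdsWithin_of_tendsto_nhds_of_eventually_within _ ?_ ?_
    · exact (Complex.continuous_ofReal.tendsto' 0 0 Complex.ofReal_zero).mono_left
        nhdsWithin_le_nhds
    · filter_upwards [self_mem_nhdsWithin] with t ht
      simpa using ht
  have hfr : ∃ᶠ ζ in 𝓝[≠] (0 : ℂ), ∫ p, F ζ p = 0 := hmap.frequently hev.frequently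
  have := han.eqOn_zero_of_preconnected_of_frequently_eq_zero isPreconnected_univ
    (Set.mem_univ 0) hfr (Set.mem_univ (1 : ℂ))
  have h1 := hFr 1
  rw [Complex.ofReal_one, one_smul, add_sub_cancel] at h1
  rw [← h1]
  exact this

end OscInt

end QPSWF

namespace QPSWF

open scoped ComplexConjugate InnerProductSpace

/-! ### The finite Fourier transform on `L²` of the square. -/

section Square

theorem isCompact_square (T : ℝ) : IsCompact (square T) := isCompact_Icc.prod isCompact_Icc

theorem measurableSet_square (T : ℝ) : MeasurableSet (square T) :=
  measurableSet_Icc.prod measurableSet_Icc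

instance isFiniteMeasure_restrict_square (T : ℝ) :
    IsFiniteMeasure ((volume : Measure (ℝ × ℝ)).restrict (square T)) :=
  ⟨by rw [Measure.restrict_apply_univ]; exact (isCompact_square T).measure_lt_top⟩

theorem mem_square_neg {T : ℝ} {z : ℝ × ℝ} : -z ∈ square T ↔ z ∈ square T := by
  simp only [square, Set.mem_prod, Set.mem_Icc, Prod.fst_neg, Prod.snd_neg]
  constructor <;> rintro ⟨⟨h1, h2⟩, h3, h4⟩ <;> refine ⟨⟨?_, ?_⟩, ?_, ?_⟩ <;> linarith

theorem measurePreserving_neg_square (T : ℝ) :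
    MeasurePreserving (fun z : ℝ × ℝ => -z) (volume.restrict (square T))
      (volume.restrict (square T)) := by
  have := (Measure.measurePreserving_neg (volume : Measure (ℝ × ℝ))).restrict_preimage
    (measurableSet_square T)
  convert! this using 2
  ext z
  exact mem_square_neg.symm

/-- The complex space `L²([-T,T]²)`. -/
noncomputable abbrev SquareL2 (T : ℝ) := Lp ℂ 2 ((volume : Measure (ℝ × ℝ)).restrict (square T))

variable {T : ℝ}

theorem memLp_indicator (f : SquareL2 T) : MemLp ((square T).indicator f) 2 volume :=
  (memLp_indicator_iff_restrict (measurableSet_square T)).2 (Lp.memLp f)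

theorem integrable_restrict (f : SquareL2 T) : Integrable f (volume.restrict (square T)) :=
  (Lp.memLp f).integrable one_le_two

theorem integrable_indicator_square (f : SquareL2 T) : Integrable ((square T).indicator f) :=
  (integrable_indicator_iff (measurableSet_square T)).2 (integrable_restrict f)

theorem memLp_osc (a : ℝ) (z : ℝ × ℝ) : MemLp (osc a z) 2 (volume.restrict (square T)) :=
  MemLp.of_bound (continuous_osc_right a z).aestronglyMeasurable 1
    (ae_of_all _ fun p => (norm_osc a z p).le)

/-- The function `p ↦ exp(-i a z·p)` in `L²([-T,T]²)`. -/
noncomputable def oscVec (T a : ℝ) (z : ℝ × ℝ) : SquareL2 T := (memLp_osc (-a) z).toLp _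

theorem inner_oscVec (a : ℝ) (z : ℝ × ℝ) (f : SquareL2 T) :
    ⟪oscVec T a z, f⟫_ℂ = oscInt a ((square T).indicator f) z := by
  rw [oscInt_indicator a (measurableSet_square T), L2.inner_def]
  refine integral_congr_ae ?_
  filter_upwards [(memLp_osc (T := T) (-a) z).coeFn_toLp] with p hp
  rw [oscVec, hp, RCLike.inner_apply, conj_osc, neg_neg, mul_comm]

theorem norm_oscVec_sq (a : ℝ) (z : ℝ × ℝ) :
    ‖oscVec T a z‖ ^ 2 = (volume : Measure (ℝ × ℝ)).real (square T) := by
  have h1 : ((‖oscVec T a z‖ ^ 2 : ℝ) : ℂ) = ((volume : Measure (ℝ × ℝ)).real (square T) : ℝ) := by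
    rw [Complex.ofReal_pow]
    refine (inner_self_eq_norm_sq_to_K (𝕜 := ℂ) (oscVec T a z)).symm.trans ?_
    rw [inner_oscVec, oscInt_indicator a (measurableSet_square T)]
    have : ∫ p in square T, osc a z p * oscVec T a z p = ∫ p in square T, (1 : ℂ) := by
      refine integral_congr_ae ?_
      filter_upwards [(memLp_osc (T := T) (-a) z).coeFn_toLp] with p hp
      rw [oscVec, hp, ← conj_osc, Complex.mul_conj, Complex.normSq_eq_norm_sq, norm_osc]
      simp
    rw [this]
    simp
  exact_mod_cast h1

theorem memLp_oscInt_square (a : ℝ) (f : SquareL2 T) :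
    MemLp (fun z => ⟪oscVec T a z, f⟫_ℂ) 2 (volume.restrict (square T)) := by
  refine MemLp.of_bound ?_ (√((volume : Measure (ℝ × ℝ)).real (square T)) * ‖f‖)
    (ae_of_all _ fun z => ?_)
  · simp only [inner_oscVec]
    exact (continuous_oscInt a (integrable_indicator_square f)).aestronglyMeasurable
  · refine (norm_inner_le_norm _ _).trans_eq ?_
    rw [← norm_oscVec_sq (T := T) a z, Real.sqrt_sq (norm_nonneg _)]

theorem norm_sq_eq_integral {α : Type*} [MeasurableSpace α] {μ : Measure α} (f : Lp ℂ 2 μ) :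
    ‖f‖ ^ 2 = ∫ x, ‖f x‖ ^ 2 ∂μ := by
  have h1 : ((‖f‖ ^ 2 : ℝ) : ℂ) = ((∫ x, ‖f x‖ ^ 2 ∂μ : ℝ) : ℂ) := by
    rw [Complex.ofReal_pow]
    refine (inner_self_eq_norm_sq_to_K (𝕜 := ℂ) f).symm.trans ?_
    rw [L2.inner_def, ← integral_complex_ofReal]
    congr with x
    rw [inner_self_eq_norm_sq_to_K]
    simp
  exact_mod_cast h1

/-- The finite Fourier transform `f ↦ ∫_{[-T,T]²} exp(i a z·p) f(p) dp` on `L²([-T,T]²)`. -/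
noncomputable def finiteFourier (T a : ℝ) : SquareL2 T →L[ℂ] SquareL2 T :=
  LinearMap.mkContinuous
    { toFun := fun f => (memLp_oscInt_square a f).toLp _
      map_add' := fun f g => by
        rw [← MemLp.toLp_add]
        congr 1 with z
        simp [inner_add_right]
      map_smul' := fun b f => by
        rw [RingHom.id_apply, ← MemLp.toLp_const_smul]
        congr 1 with z
        simp [inner_smul_right] }
    ((volume : Measure (ℝ × ℝ)).real (square T)) fun f => by
      set v := (volume : Measure (ℝ × ℝ)).real (square T) with hv
      refine le_of_sq_le_sq ?_ (by positivity)
      change ‖(memLp_oscInt_square a f).toLp _‖ ^ 2 ≤ _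
      rw [norm_sq_eq_integral]
      have h1 : ∫ z in square T, ‖(memLp_oscInt_square a f).toLp _ z‖ ^ 2 =
          ∫ z in square T, ‖⟪oscVec T a z, f⟫_ℂ‖ ^ 2 := by
        refine integral_congr_ae ?_
        filter_upwards [(memLp_oscInt_square a f).coeFn_toLp] with z hz
        rw [hz]
      rw [h1]
      have h2 : ∫ z in square T, ‖⟪oscVec T a z, f⟫_ℂ‖ ^ 2 ≤ ∫ z in square T, v * ‖f‖ ^ 2 := by
        refine integral_mono (memLp_oscInt_square a f).norm.integrable_sq (integrable_const _)
          fun z => ?_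
        rw [hv, ← norm_oscVec_sq (T := T) a z, ← mul_pow]
        exact pow_le_pow_left₀ (norm_nonneg _) (norm_inner_le_norm _ _) 2
      refine h2.trans_eq ?_
      simp [← hv]
      ring

theorem coeFn_finiteFourier (a : ℝ) (f : SquareL2 T) :
    finiteFourier T a f =ᵐ[volume.restrict (square T)]
      fun z => oscInt a ((square T).indicator f) z := by
  simp only [← inner_oscVec]
  exact (memLp_oscInt_square a f).coeFn_toLp

/-- The value of the transform of `x` at `z` is the inner product of `x` with `oscVec T a z`.
Bessel's inequality bounds the sum at each `z` by `‖oscVec T a z‖²`, the area of the square;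
integrating over `z` gives the area squared. -/
theorem hilbertSchmidtBound_finiteFourier (a : ℝ) :
    HilbertSchmidtBound (finiteFourier T a) ((volume : Measure (ℝ × ℝ)).real (square T) ^ 2) := by
  intro s hs
  have h1 (x : SquareL2 T) : ‖finiteFourier T a x‖ ^ 2 =
      ∫ z in square T, ‖⟪x, oscVec T a z⟫_ℂ‖ ^ 2 := by
    rw [norm_sq_eq_integral]
    refine integral_congr_ae ?_
    filter_upwards [coeFn_finiteFourier a x] with z hz
    rw [hz, ← inner_oscVec, norm_inner_symm]
  have h3 (x : SquareL2 T) : Integrable (fun z => ‖⟪x, oscVec T a z⟫_ℂ‖ ^ 2)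
      (volume.restrict (square T)) := by
    simp only [norm_inner_symm x]
    exact (memLp_oscInt_square a x).norm.integrable_sq
  simp only [h1]
  rw [← integral_finsetSum _ fun x _ => h3 x]
  refine (integral_mono (integrable_finsetSum _ fun x _ => h3 x) (integrable_const
    ((volume : Measure (ℝ × ℝ)).real (square T))) fun z => ?_).trans_eq ?_
  · have := hs.sum_inner_products_le (oscVec T a z) (s := Finset.univ)
    rw [norm_oscVec_sq, Finset.univ_eq_attach,
      Finset.sum_attach s fun x => ‖⟪x, oscVec T a z⟫_ℂ‖ ^ 2] at this
    exact this
  · simp [sq]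

/-- The reflection `f ↦ f(-·)` on `L²([-T,T]²)`. -/
noncomputable def reflection (T : ℝ) : SquareL2 T →L[ℂ] SquareL2 T :=
  (Lp.compMeasurePreservingₗᵢ ℂ _ (measurePreserving_neg_square T)).toContinuousLinearMap

theorem coeFn_reflection (f : SquareL2 T) :
    reflection T f =ᵐ[volume.restrict (square T)] fun z => f (-z) :=
  Lp.coeFn_compMeasurePreserving f (measurePreserving_neg_square T)

theorem integral_neg_square {E : Type*} [NormedAddCommGroup E] [NormedSpace ℝ E]
    (f : ℝ × ℝ → E) : ∫ p in square T, f (-p) = ∫ p in square T, f p :=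
  (measurePreserving_neg_square T).integral_comp (Homeomorph.neg (ℝ × ℝ)).measurableEmbedding f

theorem reflection_reflection (f : SquareL2 T) : reflection T (reflection T f) = f := by
  ext1
  filter_upwards [coeFn_reflection (reflection T f),
    (measurePreserving_neg_square T).quasiMeasurePreserving.ae_eq_comp (coeFn_reflection f)]
    with z h1 h2
  rw [h1]
  simpa using h2

theorem isSymmetric_reflection : (reflection T).IsSymmetric := by
  intro f g
  change ⟪reflection T f, g⟫_ℂ = ⟪f, reflection T g⟫_ℂ
  rw [L2.inner_def, L2.inner_def, ← integral_neg_square]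
  refine integral_congr_ae ?_
  filter_upwards [coeFn_reflection g,
    (measurePreserving_neg_square T).quasiMeasurePreserving.ae_eq_comp (coeFn_reflection f)]
    with z h1 h2
  simp only [Function.comp_apply, neg_neg] at h2
  rw [h1, h2]

theorem oscInt_indicator_reflection (a : ℝ) (f : SquareL2 T) (z : ℝ × ℝ) :
    oscInt a ((square T).indicator (reflection T f)) z =
      oscInt (-a) ((square T).indicator f) z := by
  rw [oscInt_indicator a (measurableSet_square T), oscInt_indicator _ (measurableSet_square T),
    ← integral_neg_square]
  refine integral_congr_ae ?_
  filter_upwards [(measurePreserving_neg_square T).quasiMeasurePreserving.ae_eq_comp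
    (coeFn_reflection f)] with p hp
  simp only [Function.comp_apply, neg_neg] at hp
  rw [hp, osc_neg_right]

theorem finiteFourier_reflection (a : ℝ) (f : SquareL2 T) :
    finiteFourier T a (reflection T f) = reflection T (finiteFourier T a f) := by
  ext1
  filter_upwards [coeFn_finiteFourier a (reflection T f), coeFn_reflection (finiteFourier T a f),
    (measurePreserving_neg_square T).quasiMeasurePreserving.ae_eq_comp (coeFn_finiteFourier a f)]
    with z h1 h2 h3
  rw [h1, h2, oscInt_indicator_reflection, ← oscInt_neg]
  exact h3.symm

/-- The adjoint has kernel `exp(-i a z·p)`, which is the original kernel applied to the reflected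
function; the interchange is Fubini on a bounded kernel. -/
theorem inner_finiteFourier_left (a : ℝ) (f g : SquareL2 T) :
    ⟪finiteFourier T a f, g⟫_ℂ = ⟪f, finiteFourier T a (reflection T g)⟫_ℂ := by
  have h1 : ⟪finiteFourier T a f, g⟫_ℂ =
      ∫ z in square T, ∫ p in square T, g z * (osc (-a) z p * conj (f p)) := by
    rw [L2.inner_def]
    refine integral_congr_ae ?_
    filter_upwards [coeFn_finiteFourier a f] with z hz
    rw [RCLike.inner_apply, hz, oscInt_indicator a (measurableSet_square T), integral_const_mul,
      ← integral_conj]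
    simp only [map_mul, conj_osc]
  have h2 : ⟪f, finiteFourier T a (reflection T g)⟫_ℂ =
      ∫ p in square T, ∫ z in square T, g z * (osc (-a) z p * conj (f p)) := by
    rw [L2.inner_def]
    refine integral_congr_ae ?_
    filter_upwards [coeFn_finiteFourier a (reflection T g)] with p hp
    rw [RCLike.inner_apply, hp, oscInt_indicator_reflection,
      oscInt_indicator _ (measurableSet_square T), ← integral_mul_const]
    congr with z
    rw [osc_comm]; ring
  rw [h1, h2]
  refine integral_integral_swap ?_
  have h3 : Integrable (fun w : (ℝ × ℝ) × (ℝ × ℝ) => g w.1 * conj (f w.2))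
      ((volume.restrict (square T)).prod (volume.restrict (square T))) :=
    (integrable_restrict g).mul_prod 
      ((Complex.conjCLE : ℂ →L[ℝ] ℂ).integrable_comp (integrable_restrict f))
  refine (h3.bdd_mul (continuous_osc (-a)).aestronglyMeasurable (c := 1)
    (ae_of_all _ fun w => (norm_osc _ _ _).le)).congr (ae_of_all _ fun w => ?_)
  simp only [Function.uncurry]
  ring

end Square

end QPSWF

namespace QPSWF

open scoped ComplexConjugate InnerProductSpace

/-! ### Injectivity, infinite dimension and the ordered eigenbasis. -/

section Prolate

variable {T : ℝ}

theorem isOpen_interior_square_nonempty (hT : 0 < T) : (interior (square T)).Nonempty := by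
  refine ⟨0, ?_⟩
  rw [square, interior_prod_eq, interior_Icc]
  simp [hT]

theorem eq_zero_of_oscInt_eq_zero {a : ℝ} (ha : a ≠ 0) {f : ℝ × ℝ → ℂ} (h1 : Integrable f)
    (h2 : MemLp f 2) (h0 : ∀ z, oscInt a f z = 0) : f =ᵐ[volume] 0 := by
  have h3 : planeFourier a ha (h2.toLp f) = 0 := by
    rw [Lp.eq_zero_iff_ae_eq_zero]
    filter_upwards [planeFourier_toLp ha h1 h2] with z hz
    rw [hz, h0, mul_zero]; rfl
  rw [map_eq_zero_iff _ (planeFourier a ha).injective, Lp.eq_zero_iff_ae_eq_zero] at h3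
  exact h2.coeFn_toLp.symm.trans h3

theorem square_L2_eq_zero_of_indicator {f : SquareL2 T}
    (h : (square T).indicator f =ᵐ[volume] 0) : f = 0 := by
  rw [Lp.eq_zero_iff_ae_eq_zero]
  exact (indicator_ae_eq_restrict (measurableSet_square T)).symm.trans (ae_restrict_of_ae h)

/-- A function in `L²([-T,T]²)` is zero if its Fourier transform vanishes on an open set. -/
theorem square_L2_eq_zero_of_eqOn_open {a : ℝ} (ha : a ≠ 0) {f : SquareL2 T} {U : Set (ℝ × ℝ)}
    (hU : IsOpen U) (hne : U.Nonempty)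
    (h0 : oscInt a ((square T).indicator f) =ᵐ[volume.restrict U] 0) : f = 0 := by
  have h1 := integrable_indicator_square f
  refine square_L2_eq_zero_of_indicator (eq_zero_of_oscInt_eq_zero ha h1 (memLp_indicator f) ?_)
  refine oscInt_eq_zero_of_eqOn_open a (isCompact_square T).isBounded h1
    (fun p hp => Set.indicator_of_notMem hp _) hU hne fun z hz => ?_
  exact Measure.eqOn_open_of_ae_eq h0 hU (continuous_oscInt a h1).continuousOn
    continuousOn_const hz

theorem finiteFourier_eq_zero (hT : 0 < T) {a : ℝ} (ha : a ≠ 0) {f : SquareL2 T}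
    (h : finiteFourier T a f = 0) : f = 0 := by
  refine square_L2_eq_zero_of_eqOn_open ha isOpen_interior
    (isOpen_interior_square_nonempty hT) (ae_restrict_of_ae_restrict_of_subset interior_subset ?_)
  rw [Lp.eq_zero_iff_ae_eq_zero] at h
  exact (coeFn_finiteFourier a f).symm.trans h

theorem not_finiteDimensional_squareL2 (hT : 0 < T) : ¬ FiniteDimensional ℂ (SquareL2 T) := by
  intro hfd
  -- Disjoint vertical strips of positive area inside the square; their indicators are nonzero and
  -- pairwise orthogonal.
  let s : ℕ → Set (ℝ × ℝ) := fun n =>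
    Set.Ioc (T / ((n + 1 : ℕ) + 1)) (T / (n + 1)) ×ˢ Set.Icc (-T) T
  have hs (n : ℕ) : MeasurableSet (s n) := measurableSet_Ioc.prod measurableSet_Icc
  have hsub (n : ℕ) : s n ⊆ square T := by
    refine Set.prod_mono (fun x hx => ⟨?_, hx.2.trans (div_le_self hT.le (by simp))⟩) subset_rfl
    have : 0 < T / ((n + 1 : ℕ) + 1) := by positivity
    linarith [hx.1]
  have hdisj {m n : ℕ} (h : m < n) : s m ∩ s n = ∅ := by
    ext ⟨x, y⟩
    simp only [s, Set.mem_inter_iff, Set.mem_prod, Set.mem_Ioc, Set.mem_empty_iff_false, iff_false]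
    rintro ⟨⟨⟨h1, -⟩, -⟩, ⟨-, h2⟩, -⟩
    have : T / ((n : ℝ) + 1) ≤ T / ((m + 1 : ℕ) + 1) := by
      gcongr; exact_mod_cast h
    linarith
  have hpos (n : ℕ) : (volume.restrict (square T)).real (s n) ≠ 0 := by
    rw [measureReal_restrict_apply (hs n), Set.inter_eq_left.2 (hsub n), measureReal_def,
      Measure.volume_eq_prod, Measure.prod_prod, Real.volume_Ioc, Real.volume_Icc]
    have : T / ((n + 1 : ℕ) + 1) < T / (n + 1) := by gcongr; simp
    rw [ENNReal.toReal_mul, ENNReal.toReal_ofReal (by linarith), ENNReal.toReal_ofReal (by linarith)]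
    have h1 : 0 < T / (n + 1) - T / ((n + 1 : ℕ) + 1) := by linarith
    have h2 : 0 < T - -T := by linarith
    positivity
  let v : ℕ → SquareL2 T := fun n => indicatorConstLp 2 (hs n) (measure_ne_top _ _) (1 : ℂ)
  have hin (m n : ℕ) : ⟪v m, v n⟫_ℂ = ((volume.restrict (square T)).real (s m ∩ s n) : ℝ) :=
    L2.inner_indicatorConstLp_one_indicatorConstLp_one (hs m) (hs n)
  have hv : LinearIndependent ℂ v := by
    refine linearIndependent_of_ne_zero_of_inner_eq_zero (fun n h => hpos n ?_) fun m n hmn => ?_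
    · have := hin n n
      rw [h, inner_zero_left, Set.inter_self] at this
      exact_mod_cast this.symm
    · rcases lt_or_gt_of_ne hmn with h | h
      · rw [hin, hdisj h]; simp
      · rw [hin, Set.inter_comm, hdisj h]; simp
  have := hv.finite_of_isNoetherian
  exact not_finite ℕ

/-- The complex-valued prolate spheroidal functions on the square, ordered by the size of their
eigenvalues. -/
theorem exists_prolate (hT : 0 < T) {a : ℝ} (ha : a ≠ 0) :
    ∃ (e : ℕ → SquareL2 T) (m : ℕ → ℂ), Orthonormal ℂ e ∧
      (∀ n, finiteFourier T a (e n) = m n • e n) ∧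
      (∀ n, finiteFourier T a (reflection T (e n)) = conj (m n) • e n) ∧
      (Submodule.span ℂ (Set.range e)).topologicalClosure = ⊤ ∧
      (∀ n, m n ≠ 0) ∧ (Antitone fun n => ‖m n‖ ^ 2) ∧
      Tendsto (fun n => ‖m n‖ ^ 2) atTop (𝓝 0) := by
  have hHS := hilbertSchmidtBound_finiteFourier (T := T) a
  obtain ⟨ι, e, m, heo, hm, hmR, hcl⟩ := exists_orthonormal_eigenvectors (finiteFourier T a)
    (reflection T) hHS.isCompactOperator isSymmetric_reflection reflection_reflection
    (finiteFourier_reflection a) (inner_finiteFourier_left a)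
  have hm0 (i : ι) : m i ≠ 0 := fun h => heo.ne_zero i (finiteFourier_eq_zero hT ha (by
    rw [hm, h, zero_smul]))
  -- Finitely many eigenvectors would have a closed finite-dimensional span, which density would
  -- make the whole space.
  have : Infinite ι := by
    by_contra hfin
    rw [not_infinite_iff_finite] at hfin
    have : FiniteDimensional ℂ (Submodule.span ℂ (Set.range e)) :=
      FiniteDimensional.span_of_finite ℂ (Set.finite_range e)
    rw [(Submodule.closed_of_finiteDimensional _).submodule_topologicalClosure_eq] at hcl
    rw [hcl] at this
    exact not_finiteDimensional_squareL2 hT (Module.finite_def.2 (Module.Finite.iff_fg.1 this))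
  obtain ⟨σ, hσ, hanti, hlim⟩ := exists_bijective_antitone (fun i => ‖m i‖ ^ 2)
    (fun i => by have := norm_pos_iff.2 (hm0 i); positivity) (hHS.tendsto_eigenvalues heo hm)
  refine ⟨e ∘ σ, m ∘ σ, heo.comp σ hσ.1, fun n => hm _, fun n => hmR _, ?_, fun n => hm0 _,
    hanti, hlim⟩
  rw [hσ.2.range_comp, hcl]

end Prolate

end QPSWF

namespace QPSWF

open scoped ComplexConjugate InnerProductSpace

/-! ### The `L²` transform as a limit over truncations. -/

section Truncation

theorem tendsto_eLpNorm_indicator_square {f : ℝ × ℝ → ℂ} (hf : MemLp f 2) :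
    Tendsto (fun R : ℝ => eLpNorm ((square R).indicator f - f) 2 volume) atTop (𝓝 0) := by
  have h2 : (2 : ENNReal).toReal = 2 := by simp
  simp only [eLpNorm_eq_lintegral_rpow_enorm_toReal two_ne_zero ENNReal.ofNat_ne_top, h2]
  have h0 : (0 : ENNReal) = (∫⁻ _ : ℝ × ℝ, (0 : ENNReal)) ^ (1 / (2 : ℝ)) := by simp
  rw [h0]
  refine (ENNReal.continuous_rpow_const.tendsto _).comp ?_
  refine tendsto_lintegral_filter_of_dominated_convergence' (fun z => ‖f z‖ₑ ^ (2 : ℝ))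
    (Eventually.of_forall fun R => ?_) (Eventually.of_forall fun R => ae_of_all _ fun z => ?_) ?_
    (ae_of_all _ fun z => ?_)
  · exact ((hf.1.indicator (measurableSet_square R)).sub hf.1).enorm.pow_const _
  · gcongr
    by_cases hz : z ∈ square R <;> simp [hz]
  · have := hf.eLpNorm_lt_top
    rw [eLpNorm_eq_lintegral_rpow_enorm_toReal two_ne_zero ENNReal.ofNat_ne_top, h2] at this
    exact ((ENNReal.rpow_lt_top_iff_of_pos (by norm_num)).1 this).ne
  · refine tendsto_const_nhds.congr' ?_
    filter_upwards [eventually_ge_atTop (max |z.1| |z.2|)] with R hR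
    have hz : z ∈ square R :=
      ⟨abs_le.1 ((le_max_left _ _).trans hR), abs_le.1 ((le_max_right _ _).trans hR)⟩
    simp [hz]

theorem memLp_indicator_square {f : ℝ × ℝ → ℂ} (hf : MemLp f 2) (R : ℝ) :
    MemLp ((square R).indicator f) 2 := hf.indicator (measurableSet_square R)

theorem integrable_indicator_of_memLp {f : ℝ × ℝ → ℂ} (hf : MemLp f 2) (R : ℝ) :
    Integrable ((square R).indicator f) :=
  (integrable_indicator_iff (measurableSet_square R)).2 ((hf.restrict _).integrable one_le_two)

/-- The inverse `L²` Fourier transform is the limit of the transforms of the truncations. -/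
theorem tendsto_planeFourier_symm {f : ℝ × ℝ → ℂ} (hf : MemLp f 2) :
    Tendsto (fun R : ℝ => eLpNorm (fun w => ((1 / (2 * Real.pi) : ℝ) : ℂ) *
      oscInt (-1) ((square R).indicator f) w -
        (planeFourier 1 one_ne_zero).symm (hf.toLp f) w) 2 volume) atTop (𝓝 0) := by
  refine (tendsto_eLpNorm_indicator_square hf).congr fun R => ?_
  have hR := memLp_indicator_square hf R
  set U := planeFourier 1 one_ne_zero
  have h1 : eLpNorm ((square R).indicator f - f) 2 volume = ‖hR.toLp _ - hf.toLp f‖ₑ := by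
    rw [← MemLp.toLp_sub, Lp.enorm_toLp]
  have h2 : ‖hR.toLp _ - hf.toLp f‖ₑ = ‖U.symm (hR.toLp _) - U.symm (hf.toLp f)‖ₑ := by
    rw [← map_sub, ← ofReal_norm, ← ofReal_norm, LinearIsometryEquiv.norm_map]
  rw [h1, h2, Lp.enorm_def]
  refine eLpNorm_congr_ae ?_
  filter_upwards [Lp.coeFn_sub (U.symm (hR.toLp _)) (U.symm (hf.toLp f)),
    planeFourier_symm_toLp one_ne_zero (integrable_indicator_of_memLp hf R) hR] with w h3 h4
  rw [h3, Pi.sub_apply, h4, abs_one]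

/-- Uniqueness of `L²` limits. This lets the truncation definition of the quaternionic transform be
replaced by the unitary operator. -/
theorem planeFourier_symm_ae_eq {f g : ℝ × ℝ → ℂ} (hf : MemLp f 2)
    (hg : AEStronglyMeasurable g volume)
    (h : Tendsto (fun R : ℝ => eLpNorm (fun w => ((1 / (2 * Real.pi) : ℝ) : ℂ) *
      oscInt (-1) ((square R).indicator f) w - g w) 2 volume) atTop (𝓝 0)) :
    (planeFourier 1 one_ne_zero).symm (hf.toLp f) =ᵐ[volume] g := by
  set G := (planeFourier 1 one_ne_zero).symm (hf.toLp f)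
  have hle (R : ℝ) : eLpNorm ((G : ℝ × ℝ → ℂ) - g) 2 volume ≤
      eLpNorm (fun w => ((1 / (2 * Real.pi) : ℝ) : ℂ) *
        oscInt (-1) ((square R).indicator f) w - g w) 2 volume +
      eLpNorm (fun w => ((1 / (2 * Real.pi) : ℝ) : ℂ) *
        oscInt (-1) ((square R).indicator f) w - G w) 2 volume := by
    have hm : AEStronglyMeasurable (fun w => ((1 / (2 * Real.pi) : ℝ) : ℂ) *
        oscInt (-1) ((square R).indicator f) w) volume :=
      (continuous_oscInt _ (integrable_indicator_of_memLp hf R)).aestronglyMeasurable.const_mul _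
    refine le_trans (le_of_eq ?_) (eLpNorm_sub_le (hm.sub hg)
      (hm.sub (Lp.aestronglyMeasurable G)) one_le_two)
    congr 1
    ext w
    simp
  have hlim := h.add (tendsto_planeFourier_symm hf)
  rw [add_zero] at hlim
  have h1 : eLpNorm ((G : ℝ × ℝ → ℂ) - g) 2 volume = 0 :=
    le_antisymm (ge_of_tendsto' hlim hle) bot_le
  rw [eLpNorm_eq_zero_iff ((Lp.aestronglyMeasurable G).sub hg) two_ne_zero] at h1
  filter_upwards [h1] with w hw
  exact sub_eq_zero.1 hw

end Truncation

/-! ### Extending prolate functions to the plane; the bandlimited class. -/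

section ProlateFunctions

variable {T : ℝ}

theorem indicator_square_congr {f g : ℝ × ℝ → ℂ} (h : f =ᵐ[volume.restrict (square T)] g) :
    (square T).indicator f =ᵐ[volume] (square T).indicator g := by
  filter_upwards [(ae_restrict_iff' (measurableSet_square T)).1 h] with z hz
  by_cases hzT : z ∈ square T
  · simp [hzT, hz hzT]
  · simp [hzT]

/-- Extension by zero from `L²([-T,T]²)` to `L²(ℝ²)`. -/
noncomputable def extendₗᵢ (T : ℝ) : SquareL2 T →ₗᵢ[ℂ] Lp ℂ 2 (volume : Measure (ℝ × ℝ)) where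
  toFun f := (memLp_indicator f).toLp _
  map_add' f g := by
    rw [← MemLp.toLp_add, MemLp.toLp_eq_toLp_iff, ← Set.indicator_add']
    exact indicator_square_congr
      (Lp.coeFn_add f g)
  map_smul' b f := by
    rw [RingHom.id_apply, ← MemLp.toLp_const_smul, MemLp.toLp_eq_toLp_iff]
    refine (indicator_square_congr (Lp.coeFn_smul b f)).trans (ae_of_all _ fun z => ?_)
    exact Set.indicator_const_smul_apply _ b f z
  norm_map' f := by
    change ‖(memLp_indicator f).toLp _‖ = ‖f‖
    rw [Lp.norm_toLp, eLpNorm_indicator_eq_eLpNorm_restrict (measurableSet_square T), Lp.norm_def]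

/-- The function `z ↦ (c/2π) ∫_{[-T,T]²} exp(i c z·p) f(p) dp` on the plane. -/
noncomputable def prolate (c : ℝ) (f : SquareL2 T) (z : ℝ × ℝ) : ℂ :=
  ((c / (2 * Real.pi) : ℝ) : ℂ) * oscInt c ((square T).indicator f) z

theorem continuous_prolate (c : ℝ) (f : SquareL2 T) : Continuous (prolate c f) :=
  continuous_const.mul (continuous_oscInt c (integrable_indicator_square f))

variable {c : ℝ}

theorem planeFourier_extend (hc : 0 < c) (f : SquareL2 T) :
    planeFourier c hc.ne' (extendₗᵢ T f) =ᵐ[volume] prolate c f := by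
  refine (planeFourier_toLp hc.ne' (integrable_indicator_square f) (memLp_indicator f)).trans
    (ae_of_all _ fun z => ?_)
  simp only [prolate, abs_of_pos hc]

theorem memLp_prolate (hc : 0 < c) (f : SquareL2 T) : MemLp (prolate c f) 2 :=
  (memLp_congr_ae (planeFourier_extend hc f)).1 (Lp.memLp _)

theorem toLp_prolate (hc : 0 < c) (f : SquareL2 T) :
    (memLp_prolate hc f).toLp _ = planeFourier c hc.ne' (extendₗᵢ T f) := by
  ext1
  exact (MemLp.coeFn_toLp _).trans (planeFourier_extend hc f).symm

/-- `prolate c` is an isometry, being extension by zero followed by a unitary transform. -/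
theorem integral_prolate_mul_conj (hc : 0 < c) (f g : SquareL2 T) :
    ∫ z, prolate c f z * conj (prolate c g z) = ⟪g, f⟫_ℂ := by
  rw [← (extendₗᵢ T).inner_map_map, ← (planeFourier c hc.ne').inner_map_map, L2.inner_def]
  refine integral_congr_ae ?_
  filter_upwards [planeFourier_extend hc f, planeFourier_extend hc g] with z h1 h2
  rw [h1, h2, RCLike.inner_apply]

/-- Frequency content of the prolate functions. -/
theorem planeFourier_one_symm_prolate (hc : 0 < c) (f : SquareL2 T) :
    (planeFourier 1 one_ne_zero).symm ((memLp_prolate hc f).toLp _) =ᵐ[volume]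
      dilate c⁻¹ ((square T).indicator f) := by
  have hc' : c⁻¹ ≠ 0 := (inv_pos.2 hc).ne'
  have hm := memLp_dilate hc' (memLp_indicator f)
  have h1 : (memLp_prolate hc f).toLp _ = planeFourier 1 one_ne_zero (hm.toLp _) := by
    ext1
    refine (MemLp.coeFn_toLp _).trans ((planeFourier_toLp one_ne_zero
      (((integrable_indicator_square f).comp_smul hc').const_mul _) hm).trans
      (ae_of_all _ fun z => ?_)).symm
    change _ * oscInt 1 (dilate c⁻¹ ((square T).indicator f)) z = _
    rw [oscInt_dilate hc', prolate, abs_one, abs_of_pos (inv_pos.2 hc), inv_inv, ← mul_assoc,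
      ← Complex.ofReal_mul, one_div c⁻¹, inv_inv]
    congr 2
    ring
  rw [h1, LinearIsometryEquiv.symm_apply_apply]
  exact hm.coeFn_toLp

theorem smul_mem_square (hc : 0 < c) (w : ℝ × ℝ) : c • w ∈ square (c * T) ↔ w ∈ square T := by
  simp only [square, Set.mem_prod, Set.mem_Icc, Prod.smul_fst, Prod.smul_snd, smul_eq_mul,
    ← mul_neg, mul_le_mul_iff_right₀ hc]

theorem dilate_indicator_eq_zero (hc : 0 < c) (f : ℝ × ℝ → ℂ) {w : ℝ × ℝ}
    (hw : w ∉ square (c * T)) : dilate c⁻¹ ((square T).indicator f) w = 0 := by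
  have : c⁻¹ • w ∉ square T := by
    rwa [← smul_mem_square hc, smul_inv_smul₀ hc.ne']
  simp [dilate, this]

/-- Every bandlimited function is a prolate function. -/
theorem exists_prolate_ae_eq (hc : 0 < c) {f : ℝ × ℝ → ℂ} (hf : MemLp f 2)
    (h0 : ∀ᵐ w, w ∉ square (c * T) →
      (planeFourier 1 one_ne_zero).symm (hf.toLp f) w = 0) :
    ∃ g : SquareL2 T, hf.toLp f = planeFourier c hc.ne' (extendₗᵢ T g) := by
  set G := (planeFourier 1 one_ne_zero).symm (hf.toLp f) with hG
  have hD := memLp_dilate hc.ne' (Lp.memLp G)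
  -- The preimage is the spectrum of `f`, dilated from `[-cT, cT]²` to `[-T, T]²`; restricting to
  -- the square loses nothing because `f` is bandlimited.
  refine ⟨(hD.restrict (square T)).toLp _, ?_⟩
  set g := (hD.restrict (square T)).toLp _
  have h1 : (square T).indicator g =ᵐ[volume] dilate c G := by
    have h2 : (square T).indicator g =ᵐ[volume] (square T).indicator (dilate c G) :=
      indicator_square_congr
        (hD.restrict (square T)).coeFn_toLp
    have h3 := (quasiMeasurePreserving_smul_prod hc.ne').ae h0
    filter_upwards [h2, h3] with w h4 h5
    rw [h4]
    by_cases hw : w ∈ square T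
    · simp [hw]
    · rw [Set.indicator_of_notMem hw, dilate, h5 (by rwa [smul_mem_square hc]), mul_zero]
  rw [← toLp_prolate hc, ← (planeFourier 1 one_ne_zero).symm.injective.eq_iff, ← hG]
  ext1
  refine Filter.EventuallyEq.trans ?_ (planeFourier_one_symm_prolate hc g).symm
  refine ((dilate_congr (inv_ne_zero hc.ne') h1).trans ?_).symm
  rw [dilate_dilate, mul_inv_cancel₀ hc.ne', dilate_one]

/-- The function is the isometric image of some `g` on the square, so approximating `g` by
combinations of the `e n` approximates it with the same error. -/
theorem exists_prolate_approx (hc : 0 < c) {e : ℕ → SquareL2 T}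
    (he : (Submodule.span ℂ (Set.range e)).topologicalClosure = ⊤) {f : ℝ × ℝ → ℂ}
    (hf : MemLp f 2)
    (h0 : ∀ᵐ w, w ∉ square (c * T) →
      (planeFourier 1 one_ne_zero).symm (hf.toLp f) w = 0) {ε : ENNReal} (hε : 0 < ε) :
    ∃ a : ℕ →₀ ℂ, eLpNorm (fun z => f z - ∑ n ∈ a.support, a n * prolate c (e n) z) 2 volume
      < ε := by
  obtain ⟨g, hg⟩ := exists_prolate_ae_eq hc hf h0
  have hmem : g ∈ closure (Submodule.span ℂ (Set.range e) : Set (SquareL2 T)) := by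
    rw [← Submodule.topologicalClosure_coe, he]; trivial
  obtain ⟨b, hb, hlt⟩ := EMetric.mem_closure_iff.1 hmem ε hε
  obtain ⟨a, rfl⟩ := Finsupp.mem_span_range_iff_exists_finsupp.1 hb
  refine ⟨a, ?_⟩
  have h1 : edist g (a.sum fun i x => x • e i) =
      ‖planeFourier c hc.ne' (extendₗᵢ T g) -
        ∑ n ∈ a.support, a n • planeFourier c hc.ne' (extendₗᵢ T (e n))‖ₑ := by
    have : planeFourier c hc.ne' (extendₗᵢ T g) -
        ∑ n ∈ a.support, a n • planeFourier c hc.ne' (extendₗᵢ T (e n)) =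
        planeFourier c hc.ne' (extendₗᵢ T (g - a.sum fun i x => x • e i)) := by
      simp [Finsupp.sum, map_sub, map_sum, map_smul]
    rw [this, edist_eq_enorm_sub, ← ofReal_norm, ← ofReal_norm, LinearIsometryEquiv.norm_map,
      LinearIsometry.norm_map]
  rw [h1, ← hg, Lp.enorm_def] at hlt
  refine lt_of_eq_of_lt (eLpNorm_congr_ae ?_) hlt
  have h2 : ∀ᵐ z, ∀ n, (a n • planeFourier c hc.ne' (extendₗᵢ T (e n)) :
      Lp ℂ 2 (volume : Measure (ℝ × ℝ))) z = a n * prolate c (e n) z := by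
    refine ae_all_iff.2 fun n => ?_
    filter_upwards [Lp.coeFn_smul (a n) (planeFourier c hc.ne' (extendₗᵢ T (e n))),
      planeFourier_extend hc (e n)] with z h3 h4
    rw [h3, Pi.smul_apply, h4, smul_eq_mul]
  filter_upwards [Lp.coeFn_sub (hf.toLp f)
    (∑ n ∈ a.support, a n • planeFourier c hc.ne' (extendₗᵢ T (e n))), hf.coeFn_toLp,
    Lp.coeFn_finsetSum a.support fun n => a n • planeFourier c hc.ne' (extendₗᵢ T (e n)), h2]
    with z h3 h4 h5 h6
  rw [h3, Pi.sub_apply, h4, h5]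
  simp [h6]

end ProlateFunctions

end QPSWF

namespace QPSWF

open scoped ComplexConjugate InnerProductSpace

/-! ### The sinc kernel as a superposition of plane waves. -/

section SincKernel

theorem integral_exp_eq_sinc (T k : ℝ) :
    ∫ v in -T..T, Complex.exp ((k * v : ℝ) * Complex.I) = (2 * T * Real.sinc (k * T) : ℝ) := by
  rcases eq_or_ne k 0 with rfl | hk
  · simp; ring
  · have h := intervalIntegral.integral_comp_mul_left
      (fun t : ℝ => Complex.exp ((t : ℝ) * Complex.I)) hk (a := -T) (b := T)
    rw [h, mul_neg, integral_exp_mul_I_eq_sinc, Complex.real_smul]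
    have : (k : ℂ) ≠ 0 := Complex.ofReal_ne_zero.2 hk
    push_cast
    field_simp

theorem integral_osc_square {T : ℝ} (hT : 0 < T) (c : ℝ) (x : ℝ × ℝ) :
    ∫ v in square T, osc c x v =
      ((2 * T * Real.sinc (c * T * x.1)) * (2 * T * Real.sinc (c * T * x.2)) : ℝ) := by
  have h1 (v : ℝ × ℝ) : osc c x v = Complex.exp ((c * x.1 * v.1 : ℝ) * Complex.I) *
      Complex.exp ((c * x.2 * v.2 : ℝ) * Complex.I) := by
    rw [osc, ← Complex.exp_add]
    congr 1; push_cast; ring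
  have h2 (k : ℝ) : ∫ v in Set.Icc (-T) T, Complex.exp ((k * v : ℝ) * Complex.I) =
      (2 * T * Real.sinc (k * T) : ℝ) := by
    rw [integral_Icc_eq_integral_Ioc, ← intervalIntegral.integral_of_le (by linarith),
      integral_exp_eq_sinc]
  simp only [h1]
  rw [Measure.volume_eq_prod, square, setIntegral_prod_mul
    (fun v : ℝ => Complex.exp ((c * x.1 * v : ℝ) * Complex.I))
    (fun v : ℝ => Complex.exp ((c * x.2 * v : ℝ) * Complex.I)), h2, h2, ← Complex.ofReal_mul,
    mul_right_comm c x.1 T, mul_right_comm c x.2 T]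

theorem osc_sub_left (c : ℝ) (z p v : ℝ × ℝ) : osc c (z - p) v = osc c z v * osc (-c) v p := by
  rw [osc, osc, osc, ← Complex.exp_add]
  congr 1
  simp only [Prod.fst_sub, Prod.snd_sub]
  push_cast; ring

/-- The integral of `exp(ic (z - p)·v)` over the square splits into two one-dimensional sinc
integrals. The factored form exhibits the sinc operator as a multiple of a finite transform composed
with its adjoint. -/
theorem sincKernel_eq_integral {T : ℝ} (hT : 0 < T) (c : ℝ) (z p : ℝ × ℝ) :
    (sincKernel (c * T) z p : ℂ) =
      ((c / (2 * Real.pi)) ^ 2 : ℝ) * ∫ v in square T, osc c z v * osc (-c) v p := by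
  simp only [← osc_sub_left]
  rw [integral_osc_square hT, ← Complex.ofReal_mul, sincKernel]
  congr 1
  simp only [Prod.fst_sub, Prod.snd_sub]
  field_simp

end SincKernel

/-! ### Eigenvalue identities for the prolate functions. -/

section Eigen

variable {T c : ℝ} {m : ℂ} {e : SquareL2 T}

theorem prolate_ae_eq (hm : finiteFourier T c e = m • e) :
    prolate c e =ᵐ[volume.restrict (square T)]
      fun z => ((c / (2 * Real.pi) : ℝ) : ℂ) * (m * e z) := by
  have h := coeFn_finiteFourier c e
  rw [hm] at h
  filter_upwards [h, Lp.coeFn_smul m e] with z h1 h2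
  rw [prolate, ← h1, h2, Pi.smul_apply, smul_eq_mul]

/-- The eigenvalue equation is needed only under the integral over the square, where it holds almost
everywhere, so the conclusion is valid at every point of the plane. -/
theorem integral_osc_mul_prolate (hm : finiteFourier T c e = m • e) (z : ℝ × ℝ) :
    ∫ p in square T, osc c z p * prolate c e p = m * prolate c e z := by
  rw [prolate, oscInt_indicator c (measurableSet_square T), ← mul_assoc, ← integral_const_mul]
  refine integral_congr_ae ?_
  filter_upwards [prolate_ae_eq hm] with p hp
  rw [hp]; ring

theorem setIntegral_prolate_mul_conj {m' : ℂ} {e' : SquareL2 T}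
    (hm : finiteFourier T c e = m • e) (hm' : finiteFourier T c e' = m' • e') :
    ∫ z in square T, prolate c e z * conj (prolate c e' z) =
      ((c / (2 * Real.pi)) ^ 2 : ℝ) * (m * conj m') * ⟪e', e⟫_ℂ := by
  rw [L2.inner_def, ← integral_const_mul]
  refine integral_congr_ae ?_
  filter_upwards [prolate_ae_eq hm, prolate_ae_eq hm'] with z h1 h2
  rw [h1, h2, RCLike.inner_apply]
  simp only [map_mul, Complex.conj_ofReal]
  push_cast; ring

theorem integral_osc_neg_mul_prolate (hm : finiteFourier T c e = m • e)
    (hmR : finiteFourier T c (reflection T e) = conj m • e) :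
    (fun v => ∫ p in square T, osc (-c) v p * prolate c e p) =ᵐ[volume.restrict (square T)]
      fun v => ((c / (2 * Real.pi) : ℝ) : ℂ) * (m * conj m) * e v := by
  have h := coeFn_finiteFourier c (reflection T e)
  rw [hmR] at h
  filter_upwards [h, Lp.coeFn_smul (conj m) e] with v h1 h2
  rw [oscInt_indicator_reflection, oscInt_indicator _ (measurableSet_square T), h2] at h1
  have h3 : ∫ p in square T, osc (-c) v p * prolate c e p =
      ∫ p in square T, (((c / (2 * Real.pi) : ℝ) : ℂ) * m) * (osc (-c) v p * e p) := by
    refine integral_congr_ae ?_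
    filter_upwards [prolate_ae_eq hm] with p hp
    rw [hp]; ring
  rw [h3, integral_const_mul, ← h1, Pi.smul_apply, smul_eq_mul]
  ring

/-- After Fubini the inner integral applies the adjoint transform, giving `(c/2π) |m|² e` on the
square; the outer integral over `v` turns `e` back into its prolate function at an arbitrary `z`. -/
theorem integral_sincKernel_mul_prolate (hT : 0 < T) (hm : finiteFourier T c e = m • e)
    (hmR : finiteFourier T c (reflection T e) = conj m • e) (z : ℝ × ℝ) :
    ∫ p in square T, (sincKernel (c * T) z p : ℂ) * prolate c e p =
      (‖m‖ ^ 2 * (c / (2 * Real.pi)) ^ 2 : ℝ) * prolate c e z := by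
  have hint : Integrable (prolate c e) (volume.restrict (square T)) :=
    (continuous_prolate c e).continuousOn.integrableOn_compact (isCompact_square T)
  have h1 : ∫ p in square T, (sincKernel (c * T) z p : ℂ) * prolate c e p =
      ((c / (2 * Real.pi)) ^ 2 : ℝ) *
        ∫ p in square T, ∫ v in square T, osc c z v * (osc (-c) v p * prolate c e p) := by
    rw [← integral_const_mul]
    congr with p
    rw [sincKernel_eq_integral hT, mul_assoc, ← integral_mul_const]
    simp only [mul_assoc]
  have h2 : ∫ p in square T, ∫ v in square T, osc c z v * (osc (-c) v p * prolate c e p) =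
      ∫ v in square T, ∫ p in square T, osc c z v * (osc (-c) v p * prolate c e p) := by
    refine integral_integral_swap ?_
    have h3 : Integrable (fun w : (ℝ × ℝ) × (ℝ × ℝ) => prolate c e w.1 * osc c z w.2)
        ((volume.restrict (square T)).prod (volume.restrict (square T))) :=
      hint.mul_prod ((memLp_osc c z).integrable one_le_two)
    refine (h3.bdd_mul ((continuous_osc (-c)).comp continuous_swap).aestronglyMeasurable (c := 1)
      (ae_of_all _ fun w => (norm_osc _ _ _).le)).congr (ae_of_all _ fun w => ?_)
    simp only [Function.uncurry, Function.comp_apply, Prod.fst_swap, Prod.snd_swap]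
    ring
  have h4 : ∫ v in square T, ∫ p in square T, osc c z v * (osc (-c) v p * prolate c e p) =
      (((c / (2 * Real.pi) : ℝ) : ℂ) * (m * conj m)) * ∫ v in square T, osc c z v * e v := by
    rw [← integral_const_mul]
    refine integral_congr_ae ?_
    filter_upwards [integral_osc_neg_mul_prolate hm hmR] with v hv
    rw [integral_const_mul, hv]; ring
  rw [h1, h2, h4, prolate, oscInt_indicator c (measurableSet_square T), Complex.mul_conj,
    Complex.normSq_eq_norm_sq]
  push_cast; ring

/-- The left side is the mass of the prolate function on the square, out of total mass `1`. Equality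
would make it vanish on the complement, a nonempty open set, forcing `e = 0`. -/
theorem eigenvalue_lt_one (hc : 0 < c) (hm : finiteFourier T c e = m • e) (he : ‖e‖ = 1) :
    ‖m‖ ^ 2 * (c / (2 * Real.pi)) ^ 2 < 1 := by
  have hsq (z : ℝ × ℝ) : prolate c e z * conj (prolate c e z) = ((‖prolate c e z‖ ^ 2 : ℝ) : ℂ) := by
    rw [Complex.mul_conj, Complex.normSq_eq_norm_sq]
  have hi : ⟪e, e⟫_ℂ = 1 := by rw [inner_self_eq_norm_sq_to_K, he]; simp
  have h1 : ∫ z, ‖prolate c e z‖ ^ 2 = 1 := by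
    have := integral_prolate_mul_conj hc e e
    simp only [hsq] at this
    rw [integral_complex_ofReal, hi] at this
    exact_mod_cast this
  have h2 : ∫ z in square T, ‖prolate c e z‖ ^ 2 = ‖m‖ ^ 2 * (c / (2 * Real.pi)) ^ 2 := by
    have := setIntegral_prolate_mul_conj hm hm
    simp only [hsq] at this
    rw [integral_complex_ofReal, hi, Complex.mul_conj, Complex.normSq_eq_norm_sq, mul_one,
      ← Complex.ofReal_mul, mul_comm] at this
    exact_mod_cast this
  have hint : Integrable fun z => ‖prolate c e z‖ ^ 2 := (memLp_prolate hc e).norm.integrable_sq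
  have h3 := integral_add_compl (measurableSet_square T) hint
  have h4 : 0 ≤ ∫ z in (square T)ᶜ, ‖prolate c e z‖ ^ 2 := integral_nonneg fun z => by positivity
  rw [← h2]
  refine lt_of_le_of_ne (by linarith) fun heq => ?_
  have h5 : ∫ z in (square T)ᶜ, ‖prolate c e z‖ ^ 2 = 0 := by linarith
  rw [integral_eq_zero_iff_of_nonneg (fun z => by positivity) hint.integrableOn] at h5
  have h6 : e = 0 := by
    refine square_L2_eq_zero_of_eqOn_open hc.ne' (isCompact_square T).isClosed.isOpen_compl
      ⟨(|T| + 1, 0), fun h => ?_⟩ ?_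
    · have := h.1.2
      simp only at this
      linarith [le_abs_self T]
    · filter_upwards [h5] with z hz
      have h7 : prolate c e z = 0 := by simpa using hz
      rw [prolate] at h7
      have h8 : ((c / (2 * Real.pi) : ℝ) : ℂ) ≠ 0 :=
        Complex.ofReal_ne_zero.2 (div_pos hc Real.two_pi_pos).ne'
      exact (mul_eq_zero.1 h7).resolve_left h8
  rw [h6, norm_zero] at he
  exact zero_ne_one he

end Eigen

end QPSWF

namespace QPSWF

open scoped ComplexConjugate InnerProductSpace
open Quaternion

/-! ### The splitting of the quaternions adapted to left `i` and right `j`. -/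

section QuaternionAlgebra

/-- The unit quaternion `(i + j)/√2`, which conjugates `j` to `i`. -/
noncomputable def qU : Quaternion ℝ := ⟨0, (√2)⁻¹, (√2)⁻¹, 0⟩

@[simp] theorem re_qU : qU.re = 0 := rfl
@[simp] theorem imI_qU : qU.imI = (√2)⁻¹ := rfl
@[simp] theorem imJ_qU : qU.imJ = (√2)⁻¹ := rfl
@[simp] theorem imK_qU : qU.imK = 0 := rfl
@[simp] theorem re_qI : qI.re = 0 := rfl
@[simp] theorem imI_qI : qI.imI = 1 := rfl
@[simp] theorem imJ_qI : qI.imJ = 0 := rfl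
@[simp] theorem imK_qI : qI.imK = 0 := rfl
@[simp] theorem re_qJ : qJ.re = 0 := rfl
@[simp] theorem imI_qJ : qJ.imI = 0 := rfl
@[simp] theorem imJ_qJ : qJ.imJ = 1 := rfl
@[simp] theorem imK_qJ : qJ.imK = 0 := rfl
@[simp] theorem re_expI (θ : ℝ) : (expI θ).re = Real.cos θ := rfl
@[simp] theorem imI_expI (θ : ℝ) : (expI θ).imI = Real.sin θ := rfl
@[simp] theorem imJ_expI (θ : ℝ) : (expI θ).imJ = 0 := rfl
@[simp] theorem imK_expI (θ : ℝ) : (expI θ).imK = 0 := rfl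
@[simp] theorem re_expJ (θ : ℝ) : (expJ θ).re = Real.cos θ := rfl
@[simp] theorem imI_expJ (θ : ℝ) : (expJ θ).imI = 0 := rfl
@[simp] theorem imJ_expJ (θ : ℝ) : (expJ θ).imJ = Real.sin θ := rfl
@[simp] theorem imK_expJ (θ : ℝ) : (expJ θ).imK = 0 := rfl

theorem sqrt_two_inv_mul_self : (√2)⁻¹ * (√2)⁻¹ = (1 / 2 : ℝ) := by
  rw [← mul_inv, Real.mul_self_sqrt zero_le_two, one_div]

theorem qU_mul_star : qU * star qU = 1 := by
  have := sqrt_two_inv_mul_self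
  ext <;> simp [this]; norm_num

theorem star_qU_mul : star qU * qU = 1 := by
  have := sqrt_two_inv_mul_self
  ext <;> simp [this]; norm_num

theorem qI_eq_coe : qI = ((Complex.I : ℂ) : Quaternion ℝ) := by
  ext <;> simp

theorem qU_mul_qJ : qU * qJ = qI * qU := by
  ext <;> simp

theorem qU_mul_qJ_pow (n : ℕ) : qU * qJ ^ n = qI ^ n * qU := by
  induction n with
  | zero => simp
  | succ n ih => rw [pow_succ, ← mul_assoc, ih, mul_assoc, qU_mul_qJ, ← mul_assoc, ← pow_succ]

theorem expI_eq_coe (θ : ℝ) : expI θ = ((Complex.exp (θ * Complex.I) : ℂ) : Quaternion ℝ) := by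
  ext <;> simp [Complex.exp_ofReal_mul_I_re, Complex.exp_ofReal_mul_I_im]

theorem qU_mul_expJ (θ : ℝ) : qU * expJ θ = expI θ * qU := by
  ext <;> simp <;> ring

/-- `j` anticommutes with `i`. This is the source of the frequency reflection in the second
component. -/
theorem expI_mul_qJ (θ : ℝ) : expI θ * qJ = qJ * expI (-θ) := by
  ext <;> simp

theorem star_coeComplex (z : ℂ) : star (z : Quaternion ℝ) = ((conj z : ℂ) : Quaternion ℝ) := by
  ext <;> simp

theorem norm_coeComplex (z : ℂ) : ‖(z : Quaternion ℝ)‖ = ‖z‖ := by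
  rw [← sq_eq_sq₀ (norm_nonneg _) (norm_nonneg _), sq, ← Quaternion.normSq_eq_norm_mul_self,
    Quaternion.normSq_def', ← Complex.normSq_eq_norm_sq, Complex.normSq_apply]
  simp [sq]

theorem norm_qU : ‖qU‖ = 1 := by
  have h : ‖qU‖ * ‖qU‖ = 1 := by
    rw [← Quaternion.normSq_eq_norm_mul_self, Quaternion.normSq_def']
    have := sqrt_two_inv_mul_self
    simp only [qU, sq, this]; norm_num
  nlinarith [norm_nonneg qU]

theorem norm_qJ : ‖qJ‖ = 1 := by
  have h : ‖qJ‖ * ‖qJ‖ = 1 := by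
    rw [← Quaternion.normSq_eq_norm_mul_self, Quaternion.normSq_def']
    simp
  nlinarith [norm_nonneg qJ]

/-- The inclusion `z ↦ z` of `ℂ` in the quaternions, as a continuous real-linear map. -/
noncomputable def coeCLM : ℂ →L[ℝ] Quaternion ℝ :=
  LinearMap.toContinuousLinearMap Quaternion.ofComplex.toLinearMap

/-- The embedding `z ↦ z q` of `ℂ` in the quaternions, where `q = (i + j)/√2`. -/
noncomputable def inL : ℂ →L[ℝ] Quaternion ℝ :=
  (ContinuousLinearMap.mul ℝ (Quaternion ℝ)).flip qU ∘L coeCLM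

theorem inL_apply (z : ℂ) : inL z = z * qU := rfl

/-- The embedding `w ↦ j w q` of `ℂ` in the quaternions, where `q = (i + j)/√2`. -/
noncomputable def inR : ℂ →L[ℝ] Quaternion ℝ := (ContinuousLinearMap.mul ℝ (Quaternion ℝ)) qJ ∘L inL

theorem inR_apply (w : ℂ) : inR w = qJ * inL w := rfl

theorem norm_inL (z : ℂ) : ‖inL z‖ = ‖z‖ := by
  rw [inL_apply, norm_mul, norm_qU, mul_one, norm_coeComplex]

theorem norm_inR (z : ℂ) : ‖inR z‖ = ‖z‖ := by
  rw [inR_apply, norm_mul, norm_qJ, one_mul, norm_inL]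

/-- The component `z` of a quaternion `z q + j w q`. -/
noncomputable def outL : Quaternion ℝ →L[ℝ] ℂ := LinearMap.toContinuousLinearMap
  { toFun := fun x => ⟨(x * star qU).re, (x * star qU).imI⟩
    map_add' := fun x y => by apply Complex.ext <;> simp [add_mul]
    map_smul' := fun r x => by apply Complex.ext <;> simp }

/-- The component `w` of a quaternion `z q + j w q`. -/
noncomputable def outR : Quaternion ℝ →L[ℝ] ℂ := LinearMap.toContinuousLinearMap
  -- For `w = a + b i` one has `j w = a j - b k`, whence the sign.
  { toFun := fun x => ⟨(x * star qU).imJ, -(x * star qU).imK⟩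
    map_add' := fun x y => by apply Complex.ext <;> simp [add_mul]; ring
    map_smul' := fun r x => by apply Complex.ext <;> simp; ring }

theorem outL_apply (x : Quaternion ℝ) : outL x = ⟨(x * star qU).re, (x * star qU).imI⟩ := rfl

theorem outR_apply (x : Quaternion ℝ) : outR x = ⟨(x * star qU).imJ, -(x * star qU).imK⟩ := rfl

theorem inL_add_inR_mul_star (z w : ℂ) : (inL z + inR w) * star qU = z + qJ * w := by
  rw [inR_apply, inL_apply, inL_apply, ← mul_assoc, ← add_mul, mul_assoc, qU_mul_star, mul_one]

theorem outL_add (z w : ℂ) : outL (inL z + inR w) = z := by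
  rw [outL_apply, inL_add_inR_mul_star]
  apply Complex.ext <;> simp

theorem outR_add (z w : ℂ) : outR (inL z + inR w) = w := by
  rw [outR_apply, inL_add_inR_mul_star]
  apply Complex.ext <;> simp

theorem inL_outL_add (x : Quaternion ℝ) : inL (outL x) + inR (outR x) = x := by
  have h : (inL (outL x) + inR (outR x)) * star qU = x * star qU := by
    rw [inL_add_inR_mul_star, outL_apply, outR_apply]
    set y := x * star qU
    ext <;> simp
  have h2 := congrArg (· * qU) h
  simpa only [mul_assoc, star_qU_mul, mul_one] using h2

theorem expI_mul_inL_mul_expJ (α β : ℝ) (z : ℂ) :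
    expI α * inL z * expJ β = inL (Complex.exp ((α + β : ℝ) * Complex.I) * z) := by
  rw [inL_apply, inL_apply, mul_assoc, mul_assoc, qU_mul_expJ, ← mul_assoc, ← mul_assoc,
    expI_eq_coe, expI_eq_coe, ← Quaternion.coeComplex_mul, ← Quaternion.coeComplex_mul]
  congr 2
  push_cast
  rw [add_mul, Complex.exp_add]
  ring

theorem expI_mul_inR_mul_expJ (α β : ℝ) (z : ℂ) :
    expI α * inR z * expJ β = inR (Complex.exp ((-α + β : ℝ) * Complex.I) * z) := by
  rw [inR_apply, inR_apply, ← mul_assoc, expI_mul_qJ, mul_assoc, mul_assoc, ← mul_assoc (expI _),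
    expI_mul_inL_mul_expJ]

end QuaternionAlgebra

/-! ### The quaternionic transform in complex components. -/

section QFT

theorem expI_mul_inL_mul_expJ_osc (c : ℝ) (z p : ℝ × ℝ) (u : ℂ) :
    expI (c * p.1 * z.1) * inL u * expJ (c * p.2 * z.2) = inL (osc c z p * u) := by
  rw [expI_mul_inL_mul_expJ, osc]
  congr 4
  ring_nf

theorem qft_inL_add_inR {f g : ℝ × ℝ → ℂ} (hf : Integrable f) (hg : Integrable g) (w : ℝ × ℝ) :
    qft (fun p => inL (f p) + inR (g p)) w =
      inL (((1 / (2 * Real.pi) : ℝ) : ℂ) * oscInt (-1) f w) +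
      inR (((1 / (2 * Real.pi) : ℝ) : ℂ) * oscInt (-1) g (-w.1, w.2)) := by
  have h1 (p : ℝ × ℝ) : expI (-(w.1 * p.1)) * (inL (f p) + inR (g p)) * expJ (-(w.2 * p.2)) =
      inL (osc (-1) w p * f p) + inR (osc (-1) (-w.1, w.2) p * g p) := by
    rw [mul_add, add_mul, expI_mul_inL_mul_expJ, expI_mul_inR_mul_expJ, osc, osc]
    congr 5 <;> ring_nf
  have h2 := integrable_osc_mul (-1) w hf
  have h3 := integrable_osc_mul (-1) (-w.1, w.2) hg
  simp only [qft, h1]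
  rw [integral_add (inL.integrable_comp h2) (inR.integrable_comp h3), inL.integral_comp_comm h2,
    inR.integral_comp_comm h3, smul_add, ← map_smul, ← map_smul, Complex.real_smul,
    Complex.real_smul]
  rfl

theorem eLpNorm_inL (f : ℝ × ℝ → ℂ) :
    eLpNorm (fun p => inL (f p)) 2 volume = eLpNorm f 2 volume :=
  eLpNorm_congr_norm_ae (ae_of_all _ fun p => norm_inL (f p))

theorem eLpNorm_inR (f : ℝ × ℝ → ℂ) :
    eLpNorm (fun p => inR (f p)) 2 volume = eLpNorm f 2 volume :=
  eLpNorm_congr_norm_ae (ae_of_all _ fun p => norm_inR (f p))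

theorem memLp_inL {f : ℝ × ℝ → ℂ} (hf : MemLp f 2) : MemLp (fun p => inL (f p)) 2 :=
  inL.comp_memLp' hf

theorem bandlimited_inL {W : ℝ} {f : ℝ × ℝ → ℂ} (hf : MemLp f 2)
    (h0 : ∀ᵐ w, w ∉ square W → (planeFourier 1 one_ne_zero).symm (hf.toLp f) w = 0) :
    Bandlimited W fun p => inL (f p) := by
  refine ⟨fun w => inL ((planeFourier 1 one_ne_zero).symm (hf.toLp f) w),
    ⟨memLp_inL hf, memLp_inL (Lp.memLp _), ?_⟩, ?_⟩
  · refine (tendsto_planeFourier_symm hf).congr fun R => ?_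
    rw [← eLpNorm_inL]
    congr 1
    ext1 w
    have : (square R).indicator (fun p => inL (f p)) =
        fun p => inL ((square R).indicator f p) + inR 0 := by
      ext1 p
      by_cases hp : p ∈ square R <;> simp [hp]
    rw [this, qft_inL_add_inR (g := fun _ => 0) (integrable_indicator_of_memLp hf R)
      (integrable_zero _ _ _), map_sub]
    simp [oscInt]
  · filter_upwards [h0] with w hw hwW
    rw [hw hwW, map_zero]

theorem measurePreserving_flip :
    MeasurePreserving (fun w : ℝ × ℝ => (-w.1, w.2)) volume volume :=
  (Measure.measurePreserving_neg (volume : Measure ℝ)).prod (MeasurePreserving.id volume)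

theorem measurableEmbedding_flip : MeasurableEmbedding fun w : ℝ × ℝ => (-w.1, w.2) :=
  ((Homeomorph.neg ℝ).prodCongr (Homeomorph.refl ℝ)).measurableEmbedding

theorem tendsto_eLpNorm_comp (L : Quaternion ℝ →L[ℝ] ℂ) {F : ℝ → ℝ × ℝ → Quaternion ℝ}
    (h : Tendsto (fun R => eLpNorm (F R) 2 volume) atTop (𝓝 0)) :
    Tendsto (fun R => eLpNorm (fun w => L (F R w)) 2 volume) atTop (𝓝 0) := by
  have h1 : Tendsto (fun R => ENNReal.ofReal ‖L‖ * eLpNorm (F R) 2 volume) atTop (𝓝 0) := by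
    simpa using ENNReal.Tendsto.const_mul h (Or.inr ENNReal.ofReal_ne_top)
  exact tendsto_of_tendsto_of_tendsto_of_le_of_le tendsto_const_nhds h1 (fun _ => bot_le)
    fun R => eLpNorm_le_mul_eLpNorm_of_ae_le_mul (ae_of_all _ fun w => L.le_opNorm _) 2

/-- The coordinate maps `outL` and `outR` are bounded, so they pass through the `L²` limit and the
components of the transform are the complex transforms of the components of `f`, the second one
reflected in the first frequency. -/
theorem Bandlimited.exists_components {W : ℝ} {f : ℝ × ℝ → Quaternion ℝ} (h : Bandlimited W f) :
    ∃ (hL : MemLp (fun p => outL (f p)) 2) (hR : MemLp (fun p => outR (f p)) 2),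
      (∀ᵐ w, w ∉ square W → (planeFourier 1 one_ne_zero).symm (hL.toLp _) w = 0) ∧
      (∀ᵐ w, w ∉ square W → (planeFourier 1 one_ne_zero).symm (hR.toLp _) w = 0) := by
  obtain ⟨g, ⟨hf, hg, hlim⟩, h0⟩ := h
  have hL : MemLp (fun p => outL (f p)) 2 := outL.comp_memLp' hf
  have hR : MemLp (fun p => outR (f p)) 2 := outR.comp_memLp' hf
  have hq (R : ℝ) (w : ℝ × ℝ) : qft ((square R).indicator f) w =
      inL (((1 / (2 * Real.pi) : ℝ) : ℂ) *
        oscInt (-1) ((square R).indicator fun p => outL (f p)) w) +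
      inR (((1 / (2 * Real.pi) : ℝ) : ℂ) *
        oscInt (-1) ((square R).indicator fun p => outR (f p)) (-w.1, w.2)) := by
    rw [← qft_inL_add_inR (integrable_indicator_of_memLp hL R)
      (integrable_indicator_of_memLp hR R)]
    congr 1
    ext1 p
    by_cases hp : p ∈ square R
    · simp only [Set.indicator_of_mem hp, inL_outL_add]
    · simp [hp]
  refine ⟨hL, hR, ?_, ?_⟩
  · have h1 := planeFourier_symm_ae_eq hL (g := fun w => outL (g w))
      (outL.continuous.comp_aestronglyMeasurable hg.1) (by
        refine (tendsto_eLpNorm_comp outL hlim).congr fun R => ?_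
        congr 1
        ext1 w
        rw [map_sub, hq, outL_add])
    filter_upwards [h1, h0] with w h2 h3 h4
    rw [h2, h3 h4, map_zero]
  · have hgm : AEStronglyMeasurable (fun w => outR (g w)) volume :=
      outR.continuous.comp_aestronglyMeasurable hg.1
    have h1 := planeFourier_symm_ae_eq hR (g := fun w => outR (g (-w.1, w.2)))
      (hgm.comp_quasiMeasurePreserving measurePreserving_flip.quasiMeasurePreserving) (by
        refine (tendsto_eLpNorm_comp outR hlim).congr fun R => ?_
        conv_lhs => rw [← measurePreserving_flip.map_eq]
        rw [measurableEmbedding_flip.eLpNorm_map_measure]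
        congr 1
        ext1 w
        simp only [Function.comp_apply]
        rw [map_sub, hq, outR_add]
        simp)
    filter_upwards [h1, measurePreserving_flip.quasiMeasurePreserving.ae h0] with w h2 h3 h4
    -- The square is symmetric, so reflecting a frequency does not affect the band limit.
    have h5 : ((-w.1, w.2) : ℝ × ℝ) ∉ square W := by
      intro h6
      refine h4 ⟨⟨?_, ?_⟩, h6.2⟩
      · have := h6.1.2
        simp only at this
        linarith
      · have := h6.1.1
        simp only at this
        linarith
    rw [h2, h3 h5, map_zero]

end QFT

end QPSWF

namespace QPSWF

open scoped ComplexConjugate InnerProductSpace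
open Quaternion

/-! ### Transfer to quaternion-valued functions. -/

section Main

theorem inL_mul_star_inL (z w : ℂ) :
    inL z * star (inL w) = ((z * conj w : ℂ) : Quaternion ℝ) := by
  rw [inL_apply, inL_apply, star_mul, mul_assoc, ← mul_assoc qU, qU_mul_star, one_mul,
    star_coeComplex, Quaternion.coeComplex_mul]

theorem coe_mul_inL (z w : ℂ) : (z : Quaternion ℝ) * inL w = inL (z * w) := by
  rw [inL_apply, inL_apply, ← mul_assoc, Quaternion.coeComplex_mul]

theorem coe_add_qJ_mul_inL (a b u : ℂ) :
    ((a : Quaternion ℝ) + qJ * (b : Quaternion ℝ)) * inL u = inL (a * u) + inR (b * u) := by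
  rw [add_mul, mul_assoc, coe_mul_inL, coe_mul_inL, inR_apply]

/-- Moving `j^n` across `q` turns it into `i^n`, and `i^n i^n = (-1)^n`. -/
theorem qI_pow_mul_inL_mul_qJ_pow (n : ℕ) (u : ℂ) :
    qI ^ n * inL u * qJ ^ n = inL ((-1) ^ n * u) := by
  have h : qI ^ n = ((Complex.I ^ n : ℂ) : Quaternion ℝ) := by
    rw [qI_eq_coe, ← Quaternion.coe_ofComplex, map_pow]
  rw [inL_apply, mul_assoc, mul_assoc, qU_mul_qJ_pow, ← mul_assoc, ← mul_assoc, h, inL_apply,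
    ← Quaternion.coeComplex_mul, ← Quaternion.coeComplex_mul]
  congr 2
  rw [mul_right_comm, ← mul_pow, Complex.I_mul_I]

theorem integral_inL_mul_star_inL {f g : ℝ × ℝ → ℂ} {μ : Measure (ℝ × ℝ)}
    (hf : MemLp f 2 μ) (hg : MemLp g 2 μ) :
    ∫ p, inL (f p) * star (inL (g p)) ∂μ =
      ((∫ p, f p * conj (g p) ∂μ : ℂ) : Quaternion ℝ) := by
  simp only [inL_mul_star_inL]
  exact coeCLM.integral_comp_comm (hf.integrable_mul
    ((Complex.conjCLE : ℂ →L[ℝ] ℂ).comp_memLp' hg))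

variable {T c : ℝ}

theorem bandlimited_inL_prolate (hc : 0 < c) (f : SquareL2 T) :
    Bandlimited (c * T) fun z => inL (prolate c f z) := by
  refine bandlimited_inL (memLp_prolate hc f) ?_
  filter_upwards [planeFourier_one_symm_prolate hc f] with w hw hwS
  rw [hw, dilate_indicator_eq_zero hc _ hwS]

/-- The two complex components are approximated separately, each within `ε/2`. A left coefficient `a
+ j b` applied to `φ q` yields `(a φ) q + j (b φ) q`, so one quaternion coefficient serves both
components. -/
theorem completeInBandlimited_prolate (hc : 0 < c) {e : ℕ → SquareL2 T}
    (he : (Submodule.span ℂ (Set.range e)).topologicalClosure = ⊤) :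
    CompleteInBandlimited (c * T) fun n z => inL (prolate c (e n) z) := by
  refine ⟨fun n => bandlimited_inL_prolate hc (e n), fun f hf ε hε => ?_⟩
  obtain ⟨hL, hR, hL0, hR0⟩ := hf.exists_components
  obtain ⟨a, ha⟩ := exists_prolate_approx hc he hL hL0 (ENNReal.half_pos hε.ne')
  obtain ⟨b, hb⟩ := exists_prolate_approx hc he hR hR0 (ENNReal.half_pos hε.ne')
  let N := (a.support ∪ b.support).sup id + 1
  have hN (n : ℕ) (hn : n ∈ a.support ∪ b.support) : n ∈ Finset.range N :=
    Finset.mem_range.2 (Nat.lt_succ_of_le (Finset.le_sup (f := id) hn))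
  have hsum (d : ℕ →₀ ℂ) (hd : d.support ⊆ Finset.range N) (z : ℝ × ℝ) :
      ∑ n ∈ d.support, d n * prolate c (e n) z = ∑ n ∈ Finset.range N, d n * prolate c (e n) z :=
    Finset.sum_subset hd fun n _ hn => by rw [Finsupp.notMem_support_iff.1 hn, zero_mul]
  refine ⟨N, fun n => (a n : Quaternion ℝ) + qJ * (b n : Quaternion ℝ), ?_⟩
  have hmeas {g : ℝ × ℝ → ℂ} (hg : MemLp g 2) (d : ℕ →₀ ℂ) : AEStronglyMeasurable
      (fun z => g z - ∑ n ∈ d.support, d n * prolate c (e n) z) volume :=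
    hg.1.sub (continuous_finsetSum _ fun n _ =>
      continuous_const.mul (continuous_prolate c (e n))).aestronglyMeasurable
  have hsplit : (fun p => f p - ∑ n ∈ Finset.range N,
      ((a n : Quaternion ℝ) + qJ * (b n : Quaternion ℝ)) * inL (prolate c (e n) p)) =
      (fun p => inL (outL (f p) - ∑ n ∈ a.support, a n * prolate c (e n) p)) +
      fun p => inR (outR (f p) - ∑ n ∈ b.support, b n * prolate c (e n) p) := by
    ext1 p
    rw [Pi.add_apply, hsum a fun n hn => hN n (Finset.mem_union_left _ hn),
      hsum b fun n hn => hN n (Finset.mem_union_right _ hn), map_sub, map_sub,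
      sub_add_sub_comm, inL_outL_add, map_sum, map_sum, ← Finset.sum_add_distrib]
    simp only [coe_add_qJ_mul_inL]
  rw [hsplit]
  refine (eLpNorm_add_le (inL.continuous.comp_aestronglyMeasurable (hmeas hL a))
    (inR.continuous.comp_aestronglyMeasurable (hmeas hR b)) one_le_two).trans_lt ?_
  rw [eLpNorm_inL, eLpNorm_inR, ← ENNReal.add_halves ε]
  exact ENNReal.add_lt_add ha hb

theorem finite_qft_prolate {m : ℂ} {e : SquareL2 T} (hm : finiteFourier T c e = m • e) (n : ℕ)
    (z : ℝ × ℝ) :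
    ((m * (-1) ^ n : ℂ) : Quaternion ℝ) * qI ^ n * inL (prolate c e z) * qJ ^ n =
      ∫ p in square T, expI (c * p.1 * z.1) * inL (prolate c e p) * expJ (c * p.2 * z.2) := by
  simp only [expI_mul_inL_mul_expJ_osc]
  have hint : Integrable (prolate c e) (volume.restrict (square T)) :=
    (continuous_prolate c e).continuousOn.integrableOn_compact (isCompact_square T)
  rw [inL.integral_comp_comm (integrable_osc_mul c z hint), integral_osc_mul_prolate hm,
    mul_assoc, mul_assoc, ← mul_assoc (qI ^ n), qI_pow_mul_inL_mul_qJ_pow, coe_mul_inL]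
  congr 1
  rw [mul_assoc, ← mul_assoc ((-1 : ℂ) ^ n), ← mul_pow]
  simp

theorem sincOperator_prolate (hT : 0 < T) {m : ℂ} {e : SquareL2 T}
    (hm : finiteFourier T c e = m • e)
    (hmR : finiteFourier T c (reflection T e) = conj m • e) (z : ℝ × ℝ) :
    (‖m‖ ^ 2 * (c / (2 * Real.pi)) ^ 2) • inL (prolate c e z) =
      sincOperator T (c * T) (fun p => inL (prolate c e p)) z := by
  have hint : Integrable (fun p => (sincKernel (c * T) z p : ℂ) * prolate c e p)
      (volume.restrict (square T)) := by
    have hcont : Continuous fun p => (sincKernel (c * T) z p : ℂ) * prolate c e p := by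
      have := continuous_prolate c e
      have := Real.continuous_sinc
      unfold sincKernel
      fun_prop
    exact hcont.continuousOn.integrableOn_compact (isCompact_square T)
  have h (p : ℝ × ℝ) : sincKernel (c * T) z p • inL (prolate c e p) =
      inL ((sincKernel (c * T) z p : ℂ) * prolate c e p) := by
    rw [← map_smul, Complex.real_smul]
  simp only [sincOperator, h]
  rw [inL.integral_comp_comm hint, integral_sincKernel_mul_prolate hT hm hmR, ← map_smul,
    Complex.real_smul]

end Main

end QPSWF

theorem mainTheorem2 (T c : ℝ) (hT : 0 < T) (hc : 0 < c) :
    ∃ (ψ : ℕ → ℝ × ℝ → Quaternion ℝ) (μ : ℕ → ℂ) (lam : ℕ → ℝ),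
      QPSWF.IsQPSWF T c ψ μ ∧
      (∀ n, MemLp (ψ n) 2 volume) ∧
      (∀ (n : ℕ) (z : ℝ × ℝ), lam n • ψ n z = QPSWF.sincOperator T (c * T) (ψ n) z) ∧
      (∀ n, 0 < lam n ∧ lam n < 1) ∧
      Antitone lam ∧
      Tendsto lam atTop (𝓝 0) ∧
      (∀ n m : ℕ, ∫ p in QPSWF.square T, ψ n p * star (ψ m p) =
        if n = m then (lam n : Quaternion ℝ) else 0) ∧
      (∀ n m : ℕ, ∫ p : ℝ × ℝ, ψ n p * star (ψ m p) =
        if n = m then (1 : Quaternion ℝ) else 0) := by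
  obtain ⟨e, m, heo, hm, hmR, hcl, hm0, hanti, hlim⟩ := QPSWF.exists_prolate hT hc.ne'
  have hk : 0 < (c / (2 * Real.pi)) ^ 2 := by positivity
  -- The factor `(-1)^n` in `μ n` cancels the sign produced by `i^n` on the left and `j^n` on the
  -- right.
  refine ⟨fun n z => QPSWF.inL (QPSWF.prolate c (e n) z), fun n => m n * (-1) ^ n,
    fun n => ‖m n‖ ^ 2 * (c / (2 * Real.pi)) ^ 2,
    ⟨fun n z => QPSWF.finite_qft_prolate (hm n) n z, QPSWF.completeInBandlimited_prolate hc hcl⟩,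
    fun n => QPSWF.memLp_inL (QPSWF.memLp_prolate hc (e n)),
    fun n z => QPSWF.sincOperator_prolate hT (hm n) (hmR n) z,
    fun n => ⟨mul_pos (pow_pos (norm_pos_iff.2 (hm0 n)) 2) hk,
      QPSWF.eigenvalue_lt_one hc (hm n) (heo.1 n)⟩,
    fun i j hij => mul_le_mul_of_nonneg_right (hanti hij) hk.le, ?_, fun i j => ?_, fun i j => ?_⟩
  · simpa using hlim.mul_const ((c / (2 * Real.pi)) ^ 2)
  · rw [QPSWF.integral_inL_mul_star_inL ((QPSWF.memLp_prolate hc (e i)).restrict _)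
      ((QPSWF.memLp_prolate hc (e j)).restrict _),
      QPSWF.setIntegral_prolate_mul_conj (hm i) (hm j), orthonormal_iff_ite.1 heo]
    by_cases hij : i = j
    · subst hij
      rw [if_pos rfl, if_pos rfl, mul_one, Complex.mul_conj, Complex.normSq_eq_norm_sq,
        ← Complex.ofReal_mul, mul_comm, Quaternion.coeComplex_coe]
    · rw [if_neg hij, if_neg (Ne.symm hij), mul_zero, Quaternion.coeComplex_zero]
  · rw [QPSWF.integral_inL_mul_star_inL (QPSWF.memLp_prolate hc (e i))
      (QPSWF.memLp_prolate hc (e j)), QPSWF.integral_prolate_mul_conj hc,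
      orthonormal_iff_ite.1 heo]
    by_cases hij : i = j
    · subst hij
      rw [if_pos rfl, if_pos rfl, Quaternion.coeComplex_one]
    · rw [if_neg hij, if_neg (Ne.symm hij), Quaternion.coeComplex_zero]
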